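/- Let $n\ge 1$, let $\Omega\subset\mathbb R^n$ be a non-empty open set with Lebesgue measure, let $X(\Omega)$ be any Banach function space over $\Omega$, and let $V$ be a real Banach space. Then $V$ has the Radon–Nikodým property if and only if $$R^1X(\Omega;V)=W^1X(\Omega;V)$$ (equality as sets of functions, where functions equal a.e. on $\Omega$ are identified). The notions are the following. * **Banach function space.** Let $M(\Omega)$ be the set of real-valued measurable functions on $\Omega$, modulo equality a.e. A Banach function space is a Banach space $X(\Omega)\subset M(\Omega)$ such that, with $\|f\|_X:=\infty$ for $f\in M(\Omega)\setminus X(\Omega)$: (P1) if $f\in M(\Omega)$, $g\in X(\Omega)$ and $|f|\le g$ a.e., then $f\in X(\Omega)$ and $\|f\|_X\le\|g\|_X$; (P2) if $f_k,f\in M(\Omega)$ and $0\le f_k\nearrow f$ a.e., then $\|f_k\|_X\nearrow\|f\|_X$; (P3) $\chi_A\in X(\Omega)$ for every measurable $A\subset\Omega$ with $|A|<\infty$; (P4) for every measurable $A\subset\Omega$ with $|A|<\infty$ there is a constant $C_A>0$ such that $\int_A|f|\,dx\le C_A\|f\chi_A\|_X$ for all $f\in X(\Omega)$. * $X(\Omega;V)$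 is the set of all strongly measurable $u:\Omega\to V$ with $\|u(\cdot)\|_V\in X(\Omega)$. * **Weak derivative.** For $u,v\in L^1_{\mathrm{loc}}(\Omega;V)$ we write $v=\partial_ju$ if $\int_\Omega \frac{\partial\varphi}{\partial x_j}u\,dx=-\int_\Omega\varphi v\,dx$ for all $\varphi\in C_0^\infty(\Omega)$. * **Sobolev space.** $W^1X(\Omega;V)$ is the set of all $u\in X(\Omega;V)$ whose weak derivatives $\partial_1u,\dots,\partial_nu$ exist and belong to $X(\Omega;V)$; $W^1X(\Omega):=W^1X(\Omega;\mathbb R)$. * **Reshetnyak–Sobolev space.** $R^1X(\Omega;V)$ is the set of all $u\in X(\Omega;V)$ such that (A) $\langle v^*,u\rangle\in W^1X(\Omega)$ for every $v^*\in V^*$ with $\|v^*\|\le1$, and (B) there is a non-negative $g\in X(\Omega)$ such that for every $v^*\in V^*$ with $\|v^*\|\le1$ one has $|\nabla\langle v^*,u\rangle|=\big(\sum_{j=1}^n|\partial_j\langle v^*,u\rangle|^2\big)^{1/2}\le g$ a.e. on $\Omega$. * **Radon–Nikodým property.** $V$ has it if for every $\sigma$-finite complete measure space $(S,\Sigma,\mu)$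 and every countably additive $\nu:\Sigma\to V$ of bounded variation that is absolutely continuous with respect to $\mu$, there is $f\in L^1(S,\mu;V)$ with $\nu(A)=\int_Af\,d\mu$ for all $A\in\Sigma$. -/

import Mathlib

open MeasureTheory Set Filter
open scoped ENNReal Topology

universe v w

noncomputable section

/-- A Banach space `V` has the Radon–Nikodým property if every countably additive `V`-valued measure
of bounded variation that is absolutely continuous with respect to a σ-finite complete measure `μ`
has a Bochner integrable density with respect to `μ`. The measure spaces range over the
universe `b`. -/
def HasRadonNikodymProperty.{a, b} (V : Type a) [NormedAddCommGroup V] [NormedSpace ℝ V] : Prop :=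
  ∀ (S : Type b) [MeasurableSpace S] (μ : Measure S) [SigmaFinite μ] [μ.IsComplete]
    (ν : VectorMeasure S V),
    ν.variation univ < ∞ →
    (∀ A, MeasurableSet A → μ A = 0 → ν A = 0) →
    ∃ f : S → V, Integrable f μ ∧ ∀ A, MeasurableSet A → ν A = ∫ x in A, f x ∂μ

/-- Strongly measurable functions `Ω → V`, modulo equality almost everywhere on `Ω`
(with respect to the Lebesgue measure). -/
abbrev MeasFun {n : ℕ} (Ω : Set (EuclideanSpace ℝ (Fin n))) (V : Type*) [TopologicalSpace V] :
    Type _ :=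
  EuclideanSpace ℝ (Fin n) →ₘ[volume.restrict Ω] V

/-- The characteristic function of a measurable set `A`, as an element of `M(Ω)`. -/
def indicatorFun {n : ℕ} (Ω : Set (EuclideanSpace ℝ (Fin n))) (A : Set (EuclideanSpace ℝ (Fin n)))
    (hA : MeasurableSet A) : MeasFun Ω ℝ :=
  AEEqFun.mk (A.indicator fun _ => (1 : ℝ))
    (stronglyMeasurable_const.indicator hA).aestronglyMeasurable

/-- A Banach function space `X(Ω)`. It is given by its norm, extended by the value `∞` to those
functions in `M(Ω)` that do not belong to the space; thus `X(Ω) = {f | nrm f < ∞}`. -/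
structure BanachFunctionSpace {n : ℕ} (Ω : Set (EuclideanSpace ℝ (Fin n))) where
  /-- The norm, equal to `∞` off `X(Ω)`. -/
  nrm : MeasFun Ω ℝ → ℝ≥0∞
  eq_zero_of_nrm_eq_zero : ∀ f, nrm f = 0 → f = 0
  nrm_smul : ∀ (c : ℝ) (f : MeasFun Ω ℝ), nrm (c • f) = ‖c‖ₑ * nrm f
  nrm_add_le : ∀ f g, nrm (f + g) ≤ nrm f + nrm g
  /-- Completeness of the normed space `{f | nrm f < ∞}`. -/
  complete : ∀ f : ℕ → MeasFun Ω ℝ, (∀ k, nrm (f k) < ∞) →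
    (∀ ε : ℝ≥0∞, 0 < ε → ∃ N, ∀ k, N ≤ k → ∀ l, N ≤ l → nrm (f k - f l) ≤ ε) →
    ∃ g, nrm g < ∞ ∧ Tendsto (fun k => nrm (f k - g)) atTop (𝓝 0)
  /-- The lattice property. -/
  lattice : ∀ f g : MeasFun Ω ℝ, |f| ≤ g → nrm f ≤ nrm g
  /-- The Fatou property. -/
  fatou : ∀ (f : ℕ → MeasFun Ω ℝ) (g : MeasFun Ω ℝ), 0 ≤ f 0 → Monotone f →
    (∀ᵐ x ∂(volume.restrict Ω), Tendsto (fun k => f k x) atTop (𝓝 (g x))) →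
    Tendsto (fun k => nrm (f k)) atTop (𝓝 (nrm g))
  /-- Characteristic functions of sets of finite measure belong to the space. -/
  indicatorFun_mem : ∀ (A : Set (EuclideanSpace ℝ (Fin n))) (hA : MeasurableSet A), A ⊆ Ω →
    volume A < ∞ → nrm (indicatorFun Ω A hA) < ∞
  /-- Local embedding into `L¹`. -/
  lintegral_le : ∀ (A : Set (EuclideanSpace ℝ (Fin n))) (hA : MeasurableSet A), A ⊆ Ω →
    volume A < ∞ → ∃ C : ℝ, 0 < C ∧ ∀ f, nrm f < ∞ →
      ∫⁻ x in A, ‖f x‖ₑ ≤ ENNReal.ofReal C * nrm (f * indicatorFun Ω A hA)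

/-- The pointwise norm `‖u(·)‖` of a vector-valued function. -/
def pointwiseNorm {n : ℕ} {Ω : Set (EuclideanSpace ℝ (Fin n))} {V : Type*} [NormedAddCommGroup V]
    (u : MeasFun Ω V) : MeasFun Ω ℝ :=
  AEEqFun.comp (fun y : V => ‖y‖) continuous_norm u

/-- Composition `⟨ℓ, u⟩` of a vector-valued function with a functional. -/
def pairing {n : ℕ} {Ω : Set (EuclideanSpace ℝ (Fin n))} {V : Type*} [NormedAddCommGroup V]
    [NormedSpace ℝ V] (ℓ : StrongDual ℝ V) (u : MeasFun Ω V) : MeasFun Ω ℝ :=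
  AEEqFun.comp (fun y : V => ℓ y) ℓ.continuous u

/-- The Köthe–Bochner space `X(Ω; V)`. -/
def vectorSpaceX {n : ℕ} {Ω : Set (EuclideanSpace ℝ (Fin n))} (X : BanachFunctionSpace Ω)
    (V : Type*) [NormedAddCommGroup V] : Set (MeasFun Ω V) :=
  {u | X.nrm (pointwiseNorm u) < ∞}

/-- `v` is the weak partial derivative `∂ⱼ u` on `Ω`; both functions are locally integrable
on `Ω`. -/
def IsWeakPartialDeriv {n : ℕ} {Ω : Set (EuclideanSpace ℝ (Fin n))} {V : Type*}
    [NormedAddCommGroup V] [NormedSpace ℝ V] (j : Fin n) (u v : MeasFun Ω V) : Prop :=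
  LocallyIntegrableOn u Ω ∧ LocallyIntegrableOn v Ω ∧
  ∀ φ : EuclideanSpace ℝ (Fin n) → ℝ, ContDiff ℝ (⊤ : ℕ∞) φ → HasCompactSupport φ → tsupport φ ⊆ Ω →
    ∫ x in Ω, (fderiv ℝ φ x (EuclideanSpace.single j 1)) • u x = -∫ x in Ω, φ x • v x

/-- The Sobolev space `W¹X(Ω; V)`. -/
def sobolevW {n : ℕ} {Ω : Set (EuclideanSpace ℝ (Fin n))} (X : BanachFunctionSpace Ω)
    (V : Type*) [NormedAddCommGroup V] [NormedSpace ℝ V] : Set (MeasFun Ω V) :=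
  {u | u ∈ vectorSpaceX X V ∧ ∀ j, ∃ v ∈ vectorSpaceX X V, IsWeakPartialDeriv j u v}

/-- `g` is a Reshetnyak upper gradient of `u`: a non-negative function in `X(Ω)` such that
`|∇⟨ℓ, u⟩| ≤ g` a.e. on `Ω` for every functional `ℓ` with `‖ℓ‖ ≤ 1`. -/
def IsReshetnyakUpperGradient {n : ℕ} {Ω : Set (EuclideanSpace ℝ (Fin n))}
    (X : BanachFunctionSpace Ω) {V : Type*} [NormedAddCommGroup V] [NormedSpace ℝ V]
    (u : MeasFun Ω V) (g : MeasFun Ω ℝ) : Prop :=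
  0 ≤ g ∧ X.nrm g < ∞ ∧ ∀ ℓ : StrongDual ℝ V, ‖ℓ‖ ≤ 1 →
    ∃ d : Fin n → MeasFun Ω ℝ, (∀ j, IsWeakPartialDeriv j (pairing ℓ u) (d j)) ∧
      ∀ᵐ x ∂(volume.restrict Ω), √(∑ j, ‖d j x‖ ^ 2) ≤ g x

/-- The Reshetnyak–Sobolev space `R¹X(Ω; V)`. -/
def reshetnyakR {n : ℕ} {Ω : Set (EuclideanSpace ℝ (Fin n))} (X : BanachFunctionSpace Ω)
    (V : Type*) [NormedAddCommGroup V] [NormedSpace ℝ V] : Set (MeasFun Ω V) :=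
  {u | u ∈ vectorSpaceX X V ∧ (∀ ℓ : StrongDual ℝ V, ‖ℓ‖ ≤ 1 → pairing ℓ u ∈ sobolevW X ℝ) ∧
    ∃ g, IsReshetnyakUpperGradient X u g}

end

open MeasureTheory Set Filter
open scoped ENNReal NNReal Topology

noncomputable section

/-! ### Vectors represented through functionals of norm at most one -/

section Dual

variable {α : Type*} [MeasurableSpace α] {μ : Measure α} {V : Type*} [NormedAddCommGroup V]
  [NormedSpace ℝ V]

/-! Everything is tested on functionals `ℓ` of norm at most 1, which by Hahn–Banach determine
vectors and their norms. The inclusion W¹X ⊆ R¹X holds in every Banach space, since the sum of the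
norms of the weak derivatives is an upper gradient.

Let V have the Radon–Nikodým property and let u ∈ R¹X have upper gradient g. Put μ = g dx on Ω and
d_ℓ = ∂_j⟨ℓ,u⟩ / g, so that |d_ℓ| ≤ 1. For a test function φ, the numbers ∫ φ d_ℓ dμ are the values
of all ℓ at the one vector -∫ ∂_jφ u. The functions F in L¹(μ) for which ∫ F d_ℓ dμ comes from one
vector form a closed set, and test functions are dense, so indicators are included. After passing to
an equivalent finite measure this gives a dominated V-valued measure; its density times g is ∂_j u
and has norm at most g (`HasRadonNikodymProperty.exists_dual_ae_eq_weakPartialDeriv`).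

Conversely, let R¹X ⊆ W¹X. For a bounded Lipschitz curve F in V, a bump function η and an affine
function τ of one coordinate, η · (F ∘ τ) lies in R¹X, because scalar Lipschitz functions are weakly
differentiable. Its weak derivative yields h on a cube with ℓ ∘ h = (ℓ ∘ F)' ∘ τ for each ℓ
(`exists_uniform_forall_lipschitzWith_deriv`). A vector measure dominated by a probability measure m
on a standard Borel space is encoded by such a curve once m is written as the image of Lebesgue
measure on (0, 1) under a map q; then h is a density of the measure along q ∘ τ
(`exists_coupling_density`).

Arbitrary measurable spaces are reached by martingales (`exists_integrable_density_of_coupling`).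
The densities on finite algebras form a Cauchy net in L¹: a sequence violating this involves only
countably many sets, hence lives on a standard Borel space, and there its terms are conditional
expectations of h, whose increments tend to 0. The limit of the net is the density. -/

theorem norm_le_of_forall_dual_le {y : V} {c : ℝ} (h : ∀ ℓ : StrongDual ℝ V, ‖ℓ‖ ≤ 1 → |ℓ y| ≤ c) :
    ‖y‖ ≤ c := by
  obtain ⟨ℓ, hℓ, hy⟩ := exists_dual_vector'' ℝ y
  have := h ℓ hℓ
  rw [hy] at this
  exact (le_abs_self _).trans this

theorem eq_of_forall_dual_eq {y z : V} (h : ∀ ℓ : StrongDual ℝ V, ‖ℓ‖ ≤ 1 → ℓ y = ℓ z) : y = z := by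
  rw [← sub_eq_zero, ← norm_le_zero_iff]
  refine norm_le_of_forall_dual_le fun ℓ hℓ => ?_
  simp [h ℓ hℓ]

/-- A pointwise bound on a strongly measurable function may be tested on functionals, even
if the exceptional null set depends on the functional. -/
theorem ae_norm_le_of_forall_dual_le {f : α → V} (hf : AEStronglyMeasurable f μ) {g : α → ℝ}
    (h : ∀ ℓ : StrongDual ℝ V, ‖ℓ‖ ≤ 1 → ∀ᵐ x ∂μ, ℓ (f x) ≤ g x) : ∀ᵐ x ∂μ, ‖f x‖ ≤ g x := by
  obtain ⟨t, ht, hft⟩ := hf.isSeparable_ae_range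
  obtain ⟨s, hs, hts⟩ := ht
  -- Only the norming functionals of a countable set, whose closure contains almost all values of
  -- `f`, are used, so one null set serves them all.
  choose L hL1 hL2 using fun y : V => exists_dual_vector'' ℝ y
  have hall : ∀ᵐ x ∂μ, ∀ y ∈ s, L y (f x) ≤ g x :=
    (ae_ball_iff hs).2 fun y _ => h (L y) (hL1 y)
  filter_upwards [hft, hall] with x hx hx'
  refine le_of_forall_pos_le_add fun ε hε => ?_
  obtain ⟨y, hys, hy⟩ := Metric.mem_closure_iff.1 (hts hx) (ε / 2) (half_pos hε)
  have h1 : ‖f x‖ ≤ ‖f x - y‖ + ‖y‖ := by simpa using norm_add_le (f x - y) y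
  have h2 : L y (y - f x) ≤ ‖f x - y‖ := by
    refine (le_abs_self _).trans (((L y).le_opNorm _).trans ?_)
    rw [norm_sub_rev]
    exact mul_le_of_le_one_left (norm_nonneg _) (hL1 y)
  rw [map_sub, hL2] at h2
  rw [dist_eq_norm] at hy
  have h3 := hx' y hys
  simp only [RCLike.ofReal_real_eq_id, id_eq] at h2
  linarith

/-- Integration against `d ℓ` is `C`-Lipschitz on L¹ uniformly in `ℓ`. Hence L¹ convergence makes
the representing vectors a Cauchy sequence, and their limit represents the limit function. -/
theorem isClosed_setOf_exists_dual_eq_integral_mul [CompleteSpace V]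
    {d : StrongDual ℝ V → α → ℝ} {C : ℝ}
    (hC : 0 ≤ C)
    (hm : ∀ ℓ : StrongDual ℝ V, ‖ℓ‖ ≤ 1 → AEStronglyMeasurable (d ℓ) μ)
    (hb : ∀ ℓ : StrongDual ℝ V, ‖ℓ‖ ≤ 1 → ∀ᵐ x ∂μ, |d ℓ x| ≤ C) :
    IsClosed {F : α →₁[μ] ℝ | ∃ y : V, ∀ ℓ : StrongDual ℝ V, ‖ℓ‖ ≤ 1 →
      ℓ y = ∫ x, F x * d ℓ x ∂μ} := by
  have hint : ∀ {F : α → ℝ}, Integrable F μ → ∀ ℓ : StrongDual ℝ V, ‖ℓ‖ ≤ 1 →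
      Integrable (fun x => F x * d ℓ x) μ := fun hF ℓ hℓ =>
    hF.mul_bdd (c := C) (hm ℓ hℓ) (hb ℓ hℓ)
  refine IsSeqClosed.isClosed fun F G hF hG => ?_
  choose y hy using hF
  have hdist : ∀ (F G : α →₁[μ] ℝ) (ℓ : StrongDual ℝ V), ‖ℓ‖ ≤ 1 →
      |(∫ x, F x * d ℓ x ∂μ) - ∫ x, G x * d ℓ x ∂μ| ≤ C * dist F G := by
    intro F G ℓ hℓ
    have hF := L1.integrable_coeFn F
    have hG := L1.integrable_coeFn G
    rw [← integral_sub (hint hF ℓ hℓ) (hint hG ℓ hℓ), dist_eq_norm, L1.norm_eq_integral_norm,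
      ← integral_const_mul]
    refine (abs_integral_le_integral_abs).trans (integral_mono_ae ?_ ?_ ?_)
    · exact ((hint hF ℓ hℓ).sub (hint hG ℓ hℓ)).abs
    · exact (L1.integrable_coeFn (F - G)).norm.const_mul C
    · filter_upwards [hb ℓ hℓ, Lp.coeFn_sub F G] with x hx hx'
      rw [hx', Pi.sub_apply, ← sub_mul, abs_mul, mul_comm, Real.norm_eq_abs]
      exact mul_le_mul_of_nonneg_right hx (abs_nonneg _)
  have hcau : CauchySeq y := by
    have hGc := hG.cauchySeq
    rw [Metric.cauchySeq_iff'] at hGc ⊢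
    intro ε hε
    -- Dividing by `C + 1` covers the case `C = 0`.
    obtain ⟨N, hN⟩ := hGc (ε / (C + 1)) (by positivity)
    refine ⟨N, fun n hn => ?_⟩
    have hle : ‖y n - y N‖ ≤ C * dist (F n) (F N) := norm_le_of_forall_dual_le fun ℓ hℓ => by
      rw [map_sub, hy n ℓ hℓ, hy N ℓ hℓ]
      exact hdist _ _ ℓ hℓ
    rw [dist_eq_norm]
    have h1 := hN n hn
    rw [lt_div_iff₀ (by positivity)] at h1
    nlinarith [dist_nonneg (x := F n) (y := F N)]
  obtain ⟨z, hz⟩ := cauchySeq_tendsto_of_complete hcau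
  refine ⟨z, fun ℓ hℓ => ?_⟩
  refine tendsto_nhds_unique ((ℓ.continuous.tendsto z).comp hz) ?_
  rw [tendsto_iff_dist_tendsto_zero]
  refine squeeze_zero (fun _ => dist_nonneg) (fun n => ?_)
    (by simpa using (tendsto_iff_dist_tendsto_zero.1 hG).const_mul C)
  rw [Function.comp_apply, hy n ℓ hℓ, Real.dist_eq]
  exact hdist _ _ ℓ hℓ

theorem exists_dual_eq_integral_mul_of_forall_approx [CompleteSpace V]
    {d : StrongDual ℝ V → α → ℝ} {C : ℝ}
    (hC : 0 ≤ C)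
    (hm : ∀ ℓ : StrongDual ℝ V, ‖ℓ‖ ≤ 1 → AEStronglyMeasurable (d ℓ) μ)
    (hb : ∀ ℓ : StrongDual ℝ V, ‖ℓ‖ ≤ 1 → ∀ᵐ x ∂μ, |d ℓ x| ≤ C)
    {F : α → ℝ} (hF : Integrable F μ)
    (happrox : ∀ ε > 0, ∃ G : α → ℝ, Integrable G μ ∧ ∫ x, |F x - G x| ∂μ < ε ∧
      ∃ y : V, ∀ ℓ : StrongDual ℝ V, ‖ℓ‖ ≤ 1 → ℓ y = ∫ x, G x * d ℓ x ∂μ) :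
    ∃ y : V, ∀ ℓ : StrongDual ℝ V, ‖ℓ‖ ≤ 1 → ℓ y = ∫ x, F x * d ℓ x ∂μ := by
  have hcongr : ∀ {G : α → ℝ} (hG : Integrable G μ) (ℓ : StrongDual ℝ V),
      ∫ x, hG.toL1 G x * d ℓ x ∂μ = ∫ x, G x * d ℓ x ∂μ := fun hG ℓ => by
    refine integral_congr_ae ?_
    filter_upwards [hG.coeFn_toL1] with x hx
    rw [hx]
  have hmem := (isClosed_setOf_exists_dual_eq_integral_mul (μ := μ) hC hm hb).closure_subset
    (a := hF.toL1 F) <| Metric.mem_closure_iff.2 fun ε hε => by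
      obtain ⟨G, hG, hlt, y, hy⟩ := happrox ε hε
      refine ⟨hG.toL1 G, ⟨y, fun ℓ hℓ => ?_⟩, ?_⟩
      · rw [hcongr hG, hy ℓ hℓ]
      · rw [dist_eq_norm, ← Integrable.toL1_sub, L1.norm_eq_integral_norm]
        refine lt_of_eq_of_lt (integral_congr_ae ?_) hlt
        filter_upwards [(hF.sub hG).coeFn_toL1] with x hx
        rw [hx]
        rfl
  obtain ⟨y, hy⟩ := hmem
  exact ⟨y, fun ℓ hℓ => by rw [hy ℓ hℓ, hcongr hF]⟩

/-- If a bounded family of scalar densities, indexed by the dual unit ball, represents a vector on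
every set of finite measure, then it represents a vector on every integrable function. -/
theorem exists_dual_eq_integral_mul [CompleteSpace V] {d : StrongDual ℝ V → α → ℝ} {C : ℝ}
    (hC : 0 ≤ C)
    (hm : ∀ ℓ : StrongDual ℝ V, ‖ℓ‖ ≤ 1 → AEStronglyMeasurable (d ℓ) μ)
    (hb : ∀ ℓ : StrongDual ℝ V, ‖ℓ‖ ≤ 1 → ∀ᵐ x ∂μ, |d ℓ x| ≤ C)
    (hA : ∀ A, MeasurableSet A → μ A < ∞ →
      ∃ y : V, ∀ ℓ : StrongDual ℝ V, ‖ℓ‖ ≤ 1 → ℓ y = ∫ x in A, d ℓ x ∂μ)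
    {F : α → ℝ} (hF : Integrable F μ) :
    ∃ y : V, ∀ ℓ : StrongDual ℝ V, ‖ℓ‖ ≤ 1 → ℓ y = ∫ x, F x * d ℓ x ∂μ := by
  have hint : ∀ {F : α → ℝ}, Integrable F μ → ∀ ℓ : StrongDual ℝ V, ‖ℓ‖ ≤ 1 →
      Integrable (fun x => F x * d ℓ x) μ := fun hF ℓ hℓ =>
    hF.mul_bdd (c := C) (hm ℓ hℓ) (hb ℓ hℓ)
  refine Integrable.induction (μ := μ) (P := fun F : α → ℝ => ∃ y : V, ∀ ℓ : StrongDual ℝ V, ‖ℓ‖ ≤ 1 →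
    ℓ y = ∫ x, F x * d ℓ x ∂μ) ?_ ?_ ?_ ?_ hF
  · intro c s hs hμs
    obtain ⟨y, hy⟩ := hA _ hs hμs
    refine ⟨c • y, fun ℓ hℓ => ?_⟩
    rw [map_smul, hy ℓ hℓ, smul_eq_mul, ← integral_const_mul, ← integral_indicator hs]
    congr 1 with x
    by_cases hx : x ∈ s <;> simp [hx]
  · intro f g _ hf hg hf' hg'
    obtain ⟨y, hy⟩ := hf'
    obtain ⟨z, hz⟩ := hg'
    refine ⟨y + z, fun ℓ hℓ => ?_⟩
    rw [map_add, hy ℓ hℓ, hz ℓ hℓ, ← integral_add (hint hf ℓ hℓ) (hint hg ℓ hℓ)]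
    congr 1 with x
    simp [add_mul]
  · exact isClosed_setOf_exists_dual_eq_integral_mul hC hm hb
  · intro f g hfg _ hf'
    obtain ⟨y, hy⟩ := hf'
    refine ⟨y, fun ℓ hℓ => ?_⟩
    rw [hy ℓ hℓ]
    refine integral_congr_ae ?_
    filter_upwards [hfg] with x hx
    rw [hx]

end Dual

/-! ### Passage to a complete measure space in a prescribed universe -/

section Completion

variable {α : Type} [MeasurableSpace α]

/-- The completion of a measure space, lifted to the universe `w`. -/
abbrev CompletionLift.{u} {α : Type} [MeasurableSpace α] (μ : Measure α) : Type u :=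
  ULift.{u, 0} (NullMeasurableSpace α μ)

/-- The completed measure on `CompletionLift μ`. -/
def completionLift (μ : Measure α) : Measure (CompletionLift.{w} μ) :=
  μ.completion.map ULift.up

theorem CompletionLift.measurableSet_iff {μ : Measure α} {A : Set (CompletionLift.{w} μ)} :
    MeasurableSet A ↔ NullMeasurableSet (ULift.up ⁻¹' A : Set α) μ := Iff.rfl

theorem completionLift_apply (μ : Measure α) (A : Set (CompletionLift.{w} μ)) :
    completionLift μ A = μ (ULift.up ⁻¹' A : Set α) :=
  (MeasurableEquiv.ulift.symm.map_apply (μ := μ.completion) A)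

instance (μ : Measure α) [IsFiniteMeasure μ] : IsFiniteMeasure (completionLift.{w} μ) :=
  ⟨by rw [completionLift_apply]; exact measure_lt_top _ _⟩

instance (μ : Measure α) : (completionLift.{w} μ).IsComplete :=
  ⟨fun A hA => by
    rw [completionLift_apply] at hA
    exact CompletionLift.measurableSet_iff.2 (NullMeasurableSet.of_null hA)⟩

/-- The projection from the lifted completion to the original space. -/
def CompletionLift.proj (μ : Measure α) (x : CompletionLift.{w} μ) : α := x.down

theorem CompletionLift.measurable_proj (μ : Measure α) : Measurable (proj.{w} μ) :=
  fun _ hs => CompletionLift.measurableSet_iff.2 hs.nullMeasurableSet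

theorem map_proj_completionLift (μ : Measure α) :
    (completionLift.{w} μ).map (CompletionLift.proj μ) = μ := by
  ext s hs
  rw [Measure.map_apply (CompletionLift.measurable_proj μ) hs, completionLift_apply]
  rfl

/-- Measurability for the completion is null measurability for `μ`; together with an essentially
separable range this is a.e. strong measurability. -/
theorem CompletionLift.aestronglyMeasurable_comp_up {μ : Measure α} {V : Type*}
    [NormedAddCommGroup V] {f : CompletionLift.{w} μ → V}
    (hf : AEStronglyMeasurable f (completionLift μ)) :
    AEStronglyMeasurable (fun x : α => f (ULift.up x)) μ := by
  borelize V
  rw [aestronglyMeasurable_iff_nullMeasurable_separable]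
  obtain ⟨g, hg, hfg⟩ := hf
  have hae : ∀ᵐ x ∂μ, f (ULift.up x) = g (ULift.up x) := by
    have h : completionLift μ {x | ¬ f x = g x} = 0 := hfg
    rwa [completionLift_apply] at h
  constructor
  · have h1 : NullMeasurable (fun x : α => g (ULift.up x)) μ := fun s hs =>
      CompletionLift.measurableSet_iff.1 (hg.measurable hs)
    exact h1.congr (EventuallyEq.symm hae)
  · refine ⟨range g, hg.isSeparable_range, ?_⟩
    filter_upwards [hae] with x hx
    exact ⟨_, hx.symm⟩

end Completion

/-- In a space with the Radon–Nikodým property, a bounded family of scalar densities that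
represents a vector on every measurable set comes from one strongly measurable density. -/
theorem HasRadonNikodymProperty.exists_integrable_dual_ae_eq {V : Type v} [NormedAddCommGroup V]
    [NormedSpace ℝ V] [CompleteSpace V] (hV : HasRadonNikodymProperty.{v, w} V)
    {α : Type} [MeasurableSpace α] (μ : Measure α) [IsFiniteMeasure μ]
    {d : StrongDual ℝ V → α → ℝ}
    (hm : ∀ ℓ : StrongDual ℝ V, ‖ℓ‖ ≤ 1 → AEStronglyMeasurable (d ℓ) μ)
    (hb : ∀ ℓ : StrongDual ℝ V, ‖ℓ‖ ≤ 1 → ∀ᵐ x ∂μ, |d ℓ x| ≤ 1)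
    (hA : ∀ A, MeasurableSet A →
      ∃ y : V, ∀ ℓ : StrongDual ℝ V, ‖ℓ‖ ≤ 1 → ℓ y = ∫ x in A, d ℓ x ∂μ) :
    ∃ f : α → V, Integrable f μ ∧
      ∀ ℓ : StrongDual ℝ V, ‖ℓ‖ ≤ 1 → ∀ᵐ x ∂μ, ℓ (f x) = d ℓ x := by
  have hint : ∀ ℓ : StrongDual ℝ V, ‖ℓ‖ ≤ 1 → Integrable (d ℓ) μ := fun ℓ hℓ =>
    Integrable.of_bound (hm ℓ hℓ) 1 (hb ℓ hℓ)
  have hN : ∀ B : Set α, ∃ y : V, NullMeasurableSet B μ → ∀ ℓ : StrongDual ℝ V, ‖ℓ‖ ≤ 1 →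
      ℓ y = ∫ x in B, d ℓ x ∂μ := by
    intro B
    -- The completion has more measurable sets, but each differs from its measurable hull by a null
    -- set, so the vector of the hull also represents it.
    obtain ⟨y, hy⟩ := hA (toMeasurable μ B) (measurableSet_toMeasurable μ B)
    refine ⟨y, fun hB ℓ hℓ => ?_⟩
    rw [hy ℓ hℓ, setIntegral_congr_set hB.toMeasurable_ae_eq]
  choose N hN using hN
  -- This domination gives all that is asked of the vector measure: summability over disjoint sets,
  -- bounded variation and absolute continuity.
  have hNle : ∀ B, NullMeasurableSet B μ → ‖N B‖ ≤ μ.real B := by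
    refine fun B hB => norm_le_of_forall_dual_le fun ℓ hℓ => ?_
    rw [hN B hB ℓ hℓ]
    have h := norm_setIntegral_le_of_norm_le_const_ae (f := d ℓ) (C := 1) (measure_lt_top μ B)
      (ae_restrict_of_ae (hb ℓ hℓ))
    rwa [one_mul] at h
  let pre : Set (CompletionLift.{w} μ) → Set α := fun A => ULift.up ⁻¹' A
  classical
  let ν : VectorMeasure (CompletionLift.{w} μ) V :=
    { measureOf' := fun A => if MeasurableSet A then N (pre A) else 0
      empty' := by
        rw [if_pos MeasurableSet.empty]
        have := hNle (pre ∅) (CompletionLift.measurableSet_iff.1 MeasurableSet.empty)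
        rw [show pre ∅ = ∅ from rfl] at this ⊢
        simpa using this
      not_measurable' := fun A hA => if_neg hA
      m_iUnion' := by
        intro A hA hd
        rw [if_pos (MeasurableSet.iUnion hA)]
        simp only [hA, if_true]
        have hB : ∀ i, NullMeasurableSet (pre (A i)) μ := fun i =>
          CompletionLift.measurableSet_iff.1 (hA i)
        have hBd : Pairwise (Function.onFun Disjoint fun i => pre (A i)) := fun i j hij =>
          Disjoint.preimage _ (hd hij)
        have hU : pre (⋃ i, A i) = ⋃ i, pre (A i) := preimage_iUnion
        have hsum : Summable fun i => N (pre (A i)) := by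
          refine Summable.of_norm_bounded (g := fun i => μ.real (pre (A i))) ?_
            fun i => hNle _ (hB i)
          refine ENNReal.summable_toReal ?_
          rw [← measure_iUnion₀ (fun i j hij => (hBd hij).aedisjoint) hB]
          exact measure_ne_top _ _
        have : N (pre (⋃ i, A i)) = ∑' i, N (pre (A i)) := by
          refine eq_of_forall_dual_eq fun ℓ hℓ => ?_
          rw [ℓ.map_tsum hsum, hN _ (by rw [hU]; exact NullMeasurableSet.iUnion hB) ℓ hℓ, hU,
            integral_iUnion_ae hB (fun i j hij => (hBd hij).aedisjoint)
              (hint ℓ hℓ).integrableOn]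
          exact tsum_congr fun i => (hN _ (hB i) ℓ hℓ).symm
        rw [this]
        exact hsum.hasSum }
  have hν : ∀ A, MeasurableSet A → ν A = N (pre A) := fun A hA => if_pos hA
  have hνle : ∀ A, MeasurableSet A → ‖ν A‖ₑ ≤ completionLift μ A := by
    intro A hA
    rw [hν A hA, completionLift_apply, ← ofReal_norm,
      ← ENNReal.ofReal_toReal (measure_ne_top μ _)]
    exact ENNReal.ofReal_le_ofReal (hNle _ hA)
  obtain ⟨f, hf, hfν⟩ := hV _ (completionLift.{w} μ) ν
    ((VectorMeasure.variation_le_of_forall_enorm_le hνle univ).trans_lt (measure_lt_top _ _))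
    fun A hA h0 => by simpa [h0] using hνle A hA
  have hfm := CompletionLift.aestronglyMeasurable_comp_up hf.1
  have hfi : Integrable (fun x : α => f (ULift.up x)) μ := by
    have h := integrable_map_measure (μ := completionLift.{w} μ) (f := CompletionLift.proj μ)
      (g := fun x : α => f (ULift.up x)) (by rwa [map_proj_completionLift])
      (CompletionLift.measurable_proj μ).aemeasurable
    rw [map_proj_completionLift] at h
    exact h.2 hf
  refine ⟨fun x => f (ULift.up x), hfi, fun ℓ hℓ => ?_⟩
  refine Integrable.ae_eq_of_forall_setIntegral_eq _ _ (ℓ.integrable_comp hfi) (hint ℓ hℓ) ?_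
  intro B hB _
  rw [ℓ.integral_comp_comm hfi.integrableOn, ← hN B hB.nullMeasurableSet ℓ hℓ]
  congr 1
  have hB' : MeasurableSet (CompletionLift.proj.{w} μ ⁻¹' B) := CompletionLift.measurable_proj μ hB
  have h := setIntegral_map (μ := completionLift.{w} μ) (g := CompletionLift.proj μ)
    (f := fun x : α => f (ULift.up x)) hB (by rwa [map_proj_completionLift])
    (CompletionLift.measurable_proj μ).aemeasurable
  rw [map_proj_completionLift] at h
  rw [h]
  exact (hfν _ hB').symm.trans (hν _ hB')

/-! ### Banach function spaces, pairings and the inclusion W¹X ⊆ R¹X -/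

section FunctionSpace

variable {n : ℕ} {Ω : Set (EuclideanSpace ℝ (Fin n))} {V : Type*} [NormedAddCommGroup V]

theorem coeFn_pointwiseNorm (u : MeasFun Ω V) :
    ∀ᵐ x ∂(volume.restrict Ω), pointwiseNorm u x = ‖u x‖ :=
  AEEqFun.coeFn_comp _ _ _

theorem coeFn_pairing [NormedSpace ℝ V] (ℓ : StrongDual ℝ V) (u : MeasFun Ω V) :
    ∀ᵐ x ∂(volume.restrict Ω), pairing ℓ u x = ℓ (u x) :=
  AEEqFun.coeFn_comp _ _ _

theorem coeFn_indicatorFun {A : Set (EuclideanSpace ℝ (Fin n))} (hA : MeasurableSet A) :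
    ∀ᵐ x ∂(volume.restrict Ω), indicatorFun Ω A hA x = A.indicator (fun _ => (1 : ℝ)) x :=
  AEEqFun.coeFn_mk _ _

theorem BanachFunctionSpace.nrm_le_of_ae_abs_le (X : BanachFunctionSpace Ω) {f g : MeasFun Ω ℝ}
    (h : ∀ᵐ x ∂(volume.restrict Ω), |f x| ≤ g x) : X.nrm f ≤ X.nrm g := by
  refine X.lattice f g (AEEqFun.coeFn_le.1 ?_)
  filter_upwards [h, AEEqFun.coeFn_abs f] with x hx hx'
  rwa [hx']

theorem mem_vectorSpaceX_of_ae_norm_le {X : BanachFunctionSpace Ω} {u : MeasFun Ω V}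
    {g : MeasFun Ω ℝ} (hg : X.nrm g < ∞) (h : ∀ᵐ x ∂(volume.restrict Ω), ‖u x‖ ≤ g x) :
    u ∈ vectorSpaceX X V := by
  refine (X.nrm_le_of_ae_abs_le ?_).trans_lt hg
  filter_upwards [h, coeFn_pointwiseNorm u] with x hx hx'
  rwa [hx', abs_norm]

theorem pairing_mem_vectorSpaceX [NormedSpace ℝ V] {X : BanachFunctionSpace Ω}
    {u : MeasFun Ω V} (hu : u ∈ vectorSpaceX X V) {ℓ : StrongDual ℝ V} (hℓ : ‖ℓ‖ ≤ 1) :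
    pairing ℓ u ∈ vectorSpaceX X ℝ := by
  refine mem_vectorSpaceX_of_ae_norm_le hu ?_
  filter_upwards [coeFn_pointwiseNorm u, coeFn_pairing ℓ u] with x hx hx'
  rw [hx, hx']
  exact (ℓ.le_opNorm _).trans (mul_le_of_le_one_left (norm_nonneg _) hℓ)

/-- Elements of `X(Ω; V)` are locally integrable. -/
theorem locallyIntegrableOn_of_mem_vectorSpaceX (hΩ : IsOpen Ω) {X : BanachFunctionSpace Ω}
    {u : MeasFun Ω V} (hu : u ∈ vectorSpaceX X V) : LocallyIntegrableOn u Ω := by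
  intro x hx
  obtain ⟨r, hr, hrΩ⟩ := Metric.isOpen_iff.1 hΩ x hx
  refine ⟨Metric.ball x r, mem_nhdsWithin_of_mem_nhds (Metric.ball_mem_nhds x hr), ?_⟩
  refine ⟨(u.aestronglyMeasurable).mono_set hrΩ, ?_⟩
  obtain ⟨C, -, hC⟩ := X.lintegral_le (Metric.ball x r) measurableSet_ball hrΩ measure_ball_lt_top
  have h1 := hC (pointwiseNorm u) hu
  rw [HasFiniteIntegral]
  have h2 : ∫⁻ y in Metric.ball x r, ‖u y‖ₑ = ∫⁻ y in Metric.ball x r, ‖pointwiseNorm u y‖ₑ := by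
    refine lintegral_congr_ae ?_
    filter_upwards [ae_restrict_of_ae_restrict_of_subset hrΩ (coeFn_pointwiseNorm u)] with y hy
    rw [hy, enorm_norm]
  rw [h2]
  refine h1.trans_lt (ENNReal.mul_lt_top ENNReal.ofReal_lt_top
    ((X.nrm_le_of_ae_abs_le ?_).trans_lt hu))
  filter_upwards [coeFn_pointwiseNorm u, coeFn_indicatorFun (Ω := Ω) measurableSet_ball,
    AEEqFun.coeFn_mul (pointwiseNorm u) (indicatorFun Ω (Metric.ball x r) measurableSet_ball)]
    with y hy hy' hy''
  rw [hy'', Pi.mul_apply, hy', hy]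
  by_cases hyb : y ∈ Metric.ball x r <;> simp [hyb]

/-- A non-negative element of `X(Ω)` is locally integrable. -/
theorem locallyIntegrableOn_of_nrm_lt_top (hΩ : IsOpen Ω) {X : BanachFunctionSpace Ω}
    {g : MeasFun Ω ℝ} (hg0 : 0 ≤ g) (hg : X.nrm g < ∞) : LocallyIntegrableOn g Ω := by
  refine locallyIntegrableOn_of_mem_vectorSpaceX hΩ (mem_vectorSpaceX_of_ae_norm_le hg ?_)
  filter_upwards [AEEqFun.coeFn_le.2 hg0, AEEqFun.coeFn_zero (α := EuclideanSpace ℝ (Fin n))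
    (β := ℝ) (μ := volume.restrict Ω)] with x hx hx'
  rw [hx'] at hx
  exact (Real.norm_of_nonneg hx).le

theorem integrableOn_smul_of_tsupport_subset [NormedSpace ℝ V]
    {φ : EuclideanSpace ℝ (Fin n) → ℝ} (hφ : Continuous φ) (hφc : HasCompactSupport φ)
    (hφΩ : tsupport φ ⊆ Ω) {f : EuclideanSpace ℝ (Fin n) → V} (hf : LocallyIntegrableOn f Ω) :
    IntegrableOn (fun x => φ x • f x) Ω := by
  obtain ⟨C, hC⟩ := hφc.exists_bound_of_continuous hφ
  have h1 : IntegrableOn (fun x => φ x • f x) (tsupport φ) :=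
    Integrable.bdd_smul (hf.integrableOn_compact_subset hφΩ hφc) C
      hφ.aestronglyMeasurable (Eventually.of_forall hC)
  refine Integrable.integrableOn ((integrableOn_iff_integrable_of_support_subset fun x hx => ?_).1 h1)
  exact subset_tsupport φ fun h0 => hx (by simp [h0])

/-- A continuous functional commutes with both Bochner integrals in the definition. -/
theorem IsWeakPartialDeriv.pairing [NormedSpace ℝ V] [CompleteSpace V] {j : Fin n}
    {u v : MeasFun Ω V} (h : IsWeakPartialDeriv j u v) (ℓ : StrongDual ℝ V) :
    IsWeakPartialDeriv j (pairing ℓ u) (pairing ℓ v) := by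
  refine ⟨(ℓ.locallyIntegrableOn_comp h.1).congr (EventuallyEq.symm (coeFn_pairing ℓ u)),
    (ℓ.locallyIntegrableOn_comp h.2.1).congr (EventuallyEq.symm (coeFn_pairing ℓ v)),
    fun φ hφ hφc hφΩ => ?_⟩
  have h3 := congrArg ℓ (h.2.2 φ hφ hφc hφΩ)
  have hd : Continuous fun x => fderiv ℝ φ x (EuclideanSpace.single j 1) :=
    (hφ.continuous_fderiv (by simp)).clm_apply continuous_const
  have hds : tsupport (fun x => fderiv ℝ φ x (EuclideanSpace.single j 1)) ⊆ tsupport φ :=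
    tsupport_fderiv_apply_subset ℝ _
  have hdc : HasCompactSupport fun x => fderiv ℝ φ x (EuclideanSpace.single j 1) :=
    hφc.fderiv_apply ℝ _
  rw [map_neg, ← ℓ.integral_comp_comm
      (integrableOn_smul_of_tsupport_subset hd hdc (hds.trans hφΩ) h.1),
    ← ℓ.integral_comp_comm
      (integrableOn_smul_of_tsupport_subset hφ.continuous hφc hφΩ h.2.1)] at h3
  convert h3 using 1
  · refine integral_congr_ae ?_
    filter_upwards [coeFn_pairing ℓ u] with x hx
    simp [hx]
  · congr 1
    refine integral_congr_ae ?_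
    filter_upwards [coeFn_pairing ℓ v] with x hx
    simp [hx]

/-- The sum of the `‖∂ⱼu‖` bounds the Euclidean norm of the gradient of every `⟨ℓ, u⟩` with `‖ℓ‖ ≤
1`, and does not depend on `ℓ`. -/
theorem sobolevW_subset_reshetnyakR [NormedSpace ℝ V] [CompleteSpace V]
    (X : BanachFunctionSpace Ω) : sobolevW X V ⊆ reshetnyakR X V := by
  rintro u ⟨hu, hv⟩
  choose v hvX hv using hv
  refine ⟨hu, fun ℓ hℓ => ⟨pairing_mem_vectorSpaceX hu hℓ, fun j =>
    ⟨_, pairing_mem_vectorSpaceX (hvX j) hℓ, (hv j).pairing ℓ⟩⟩, ∑ j, pointwiseNorm (v j), ?_, ?_, ?_⟩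
  · refine AEEqFun.coeFn_le.1 ?_
    filter_upwards [ae_all_iff.2 fun j => coeFn_pointwiseNorm (v j), AEEqFun.coeFn_zero
      (α := EuclideanSpace ℝ (Fin n)) (β := ℝ) (μ := volume.restrict Ω),
      AEEqFun.coeFn_finsetSum Finset.univ fun j => pointwiseNorm (v j)] with x h1 h2 h3
    rw [h2, h3, Finset.sum_apply]
    exact Finset.sum_nonneg fun j _ => (h1 j).symm ▸ norm_nonneg _
  · have h0 : X.nrm 0 = 0 := by simpa using X.nrm_smul 0 0
    refine (Finset.le_sum_of_subadditive X.nrm h0.le X.nrm_add_le _ _).trans_lt ?_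
    exact ENNReal.sum_lt_top.2 fun j _ => hvX j
  · intro ℓ hℓ
    refine ⟨fun j => pairing ℓ (v j), fun j => (hv j).pairing ℓ, ?_⟩
    filter_upwards [ae_all_iff.2 fun j => coeFn_pointwiseNorm (v j),
      ae_all_iff.2 fun j => coeFn_pairing ℓ (v j),
      AEEqFun.coeFn_finsetSum Finset.univ fun j => pointwiseNorm (v j)] with x h1 h2 h3
    rw [h3, Finset.sum_apply]
    simp only [h1, h2]
    calc √(∑ j, ‖ℓ (v j x)‖ ^ 2) ≤ √((∑ j, ‖ℓ (v j x)‖) ^ 2) :=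
          Real.sqrt_le_sqrt (Finset.sum_sq_le_sq_sum_of_nonneg fun j _ => norm_nonneg _)
      _ = ∑ j, ‖ℓ (v j x)‖ := Real.sqrt_sq (Finset.sum_nonneg fun j _ => norm_nonneg _)
      _ ≤ ∑ j, ‖v j x‖ := Finset.sum_le_sum fun j _ =>
          (ℓ.le_opNorm _).trans (mul_le_of_le_one_left (norm_nonneg _) hℓ)

end FunctionSpace

/-- Indicators of sets of finite measure are approximated in `L¹` by test functions on an open
set `Ω`, for any measure carried by `Ω` that is finite on the compact subsets of `Ω`. -/
theorem exists_contDiff_integral_abs_indicator_sub_lt {n : ℕ}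
    {Ω : Set (EuclideanSpace ℝ (Fin n))} (hΩ : IsOpen Ω) {μ : Measure (EuclideanSpace ℝ (Fin n))}
    (hμΩ : μ Ωᶜ = 0) (hμK : ∀ K ⊆ Ω, IsCompact K → μ K < ∞)
    {A : Set (EuclideanSpace ℝ (Fin n))} (hA : MeasurableSet A) (hμA : μ A < ∞)
    {ε : ℝ} (hε : 0 < ε) :
    ∃ φ : EuclideanSpace ℝ (Fin n) → ℝ, ContDiff ℝ (⊤ : ℕ∞) φ ∧ HasCompactSupport φ ∧
      tsupport φ ⊆ Ω ∧ Integrable φ μ ∧ ∫ x, |A.indicator (fun _ => 1) x - φ x| ∂μ < ε := by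
  have hε3 : ENNReal.ofReal (ε / 3) ≠ 0 := by simpa using by positivity
  -- inner approximation by a compact set
  have hfin : IsFiniteMeasure (μ.restrict A) := ⟨by simpa using hμA⟩
  obtain ⟨K, hKA, hK, hKlt⟩ := (hA.inter hΩ.measurableSet).exists_isCompact_sdiff_lt
    (μ := μ.restrict A) (measure_ne_top _ _) hε3
  have hKΩ : K ⊆ Ω := hKA.trans inter_subset_right
  have hAK : μ (A \ K) < ENNReal.ofReal (ε / 3) := by
    refine lt_of_le_of_lt ?_ hKlt
    have hsub : A \ K ⊆ ((A ∩ Ω) \ K) ∩ A ∪ Ωᶜ := by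
      rintro x ⟨hxA, hxK⟩
      by_cases hx : x ∈ Ω
      · exact Or.inl ⟨⟨⟨hxA, hx⟩, hxK⟩, hxA⟩
      · exact Or.inr hx
    calc μ (A \ K) ≤ μ (((A ∩ Ω) \ K) ∩ A) + μ Ωᶜ :=
          (measure_mono hsub).trans (measure_union_le _ _)
      _ = μ.restrict A ((A ∩ Ω) \ K) := by
          rw [hμΩ, add_zero, Measure.restrict_apply
            ((hA.inter hΩ.measurableSet).diff hK.measurableSet)]
  -- outer approximation by an open set
  obtain ⟨K', hK', hKK', hK'Ω⟩ := exists_compact_between hK hΩ hKΩ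
  -- `μ` may blow up near the boundary of `Ω`, so outer regularity is applied to its finite
  -- restriction to a compact neighbourhood of `K` in `Ω`.
  have hfin' : IsFiniteMeasure (μ.restrict K') := ⟨by simpa using hμK K' hK'Ω hK'⟩
  obtain ⟨U, hKU, hU, hUlt⟩ := hK.exists_isOpen_lt_add (μ := μ.restrict K') hε3
  obtain ⟨δ, hδ, hδU⟩ := hK.exists_cthickening_subset_open (hU.inter isOpen_interior)
    (subset_inter hKU hKK')
  set T := Metric.cthickening δ K with hT
  have hTK' : T ⊆ K' := hδU.trans (inter_subset_right.trans interior_subset)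
  have hKT : K ⊆ T := Metric.self_subset_cthickening K
  have hTc : IsCompact T := hK.cthickening
  have hμT : μ T < ∞ := hμK T (hTK'.trans hK'Ω) hTc
  have hTK : μ (T \ K) ≤ ENNReal.ofReal (ε / 3) := by
    rw [measure_sdiff hKT hK.measurableSet.nullMeasurableSet
      ((measure_mono hKT).trans_lt hμT).ne, tsub_le_iff_left]
    have h1 : μ T ≤ μ.restrict K' U := by
      rw [Measure.restrict_apply hU.measurableSet]
      exact measure_mono (subset_inter (hδU.trans inter_subset_left) hTK')
    have h2 : μ.restrict K' K ≤ μ K := Measure.restrict_apply_le _ _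
    exact h1.trans (hUlt.le.trans (by gcongr))
  obtain ⟨φ, hφ, hφr, hφs, hφ1⟩ := exists_contMDiff_support_eq_eq_one_iff
    (modelWithCornersSelf ℝ (EuclideanSpace ℝ (Fin n))) (n := (⊤ : ℕ∞))
    (Metric.isOpen_thickening (δ := δ) (E := K)) hK.isClosed (Metric.self_subset_thickening hδ K)
  have hts : tsupport φ ⊆ T := by
    rw [tsupport, hφs]
    exact Metric.closure_thickening_subset_cthickening δ K
  have hφc : HasCompactSupport φ := hTc.of_isClosed_subset (isClosed_tsupport φ) hts
  have hφcont : Continuous φ := hφ.contDiff.continuous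
  have hφ01 : ∀ x, 0 ≤ φ x ∧ φ x ≤ 1 := fun x => hφr ⟨x, rfl⟩
  have hφint : Integrable φ μ := by
    have h1 : IntegrableOn φ T μ := by
      refine Measure.integrableOn_of_bounded (M := 1) hμT.ne hφcont.aestronglyMeasurable ?_
      exact Eventually.of_forall fun x => by
        rw [Real.norm_of_nonneg (hφ01 x).1]
        exact (hφ01 x).2
    exact (integrableOn_iff_integrable_of_support_subset ((subset_tsupport φ).trans hts)).1 h1
  refine ⟨φ, hφ.contDiff, hφc, hts.trans (hTK'.trans hK'Ω), hφint, ?_⟩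
  have hAKm : MeasurableSet (A \ K) := hA.diff hK.measurableSet
  have hTKm : MeasurableSet (T \ K) := hTc.measurableSet.diff hK.measurableSet
  have hi1 : Integrable ((A \ K).indicator fun _ => (1 : ℝ)) μ :=
    (integrable_indicator_iff hAKm).2 (integrableOn_const ((measure_mono sdiff_subset).trans_lt hμA).ne)
  have hi2 : Integrable ((T \ K).indicator fun _ => (1 : ℝ)) μ :=
    (integrable_indicator_iff hTKm).2 (integrableOn_const ((measure_mono sdiff_subset).trans_lt hμT).ne)
  -- The two functions agree on `K`, where both are 1; off `K`, the indicator is carried by `A \ K`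
  -- and `φ` by `T \ K`.
  have hle : ∫ x, |A.indicator (fun _ => 1) x - φ x| ∂μ ≤
      ∫ x, ((A \ K).indicator (fun _ => (1 : ℝ)) x + (T \ K).indicator (fun _ => (1 : ℝ)) x) ∂μ := by
    refine integral_mono_of_nonneg (Eventually.of_forall fun x => abs_nonneg _) (hi1.add hi2)
      (Eventually.of_forall fun x => ?_)
    have hx := hφ01 x
    by_cases hxK : x ∈ K
    · simp [hxK, (hKA hxK).1, (hφ1 x).1 hxK]
    · by_cases hxT : x ∈ T
      · by_cases hxA : x ∈ A <;> simp [hxK, hxT, hxA] <;> rw [abs_le] <;>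
          constructor <;> linarith
      · have h0 : φ x = 0 := image_eq_zero_of_notMem_tsupport fun h => hxT (hts h)
        by_cases hxA : x ∈ A <;> simp [hxK, hxT, hxA, h0]
  refine hle.trans_lt ?_
  rw [integral_add hi1 hi2, integral_indicator_const _ hAKm, integral_indicator_const _ hTKm,
    smul_eq_mul, smul_eq_mul, mul_one, mul_one]
  have h1 : μ.real (A \ K) ≤ ε / 3 :=
    ENNReal.toReal_le_of_le_ofReal (by positivity) hAK.le
  have h2 : μ.real (T \ K) ≤ ε / 3 := ENNReal.toReal_le_of_le_ofReal (by positivity) hTK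
  linarith

/-! ### The Radon–Nikodým property implies R¹X ⊆ W¹X -/

section Reshetnyak

variable {n : ℕ} {Ω : Set (EuclideanSpace ℝ (Fin n))}
  {V : Type v} [NormedAddCommGroup V] [NormedSpace ℝ V] [CompleteSpace V]

/-- In a space with the Radon–Nikodým property, the weak partial derivatives of the pairings `⟨ℓ, u⟩`
come from one strongly measurable function, if they are dominated by one locally integrable
function. -/
theorem HasRadonNikodymProperty.exists_dual_ae_eq_weakPartialDeriv
    (hV : HasRadonNikodymProperty.{v, w} V) (hΩ : IsOpen Ω) {u : MeasFun Ω V}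
    (hu : LocallyIntegrableOn u Ω) {g : MeasFun Ω ℝ} (hg : LocallyIntegrableOn g Ω) {j : Fin n}
    {D : StrongDual ℝ V → MeasFun Ω ℝ}
    (hD : ∀ ℓ : StrongDual ℝ V, ‖ℓ‖ ≤ 1 → IsWeakPartialDeriv j (pairing ℓ u) (D ℓ))
    (hDg : ∀ ℓ : StrongDual ℝ V, ‖ℓ‖ ≤ 1 → ∀ᵐ x ∂(volume.restrict Ω), |D ℓ x| ≤ g x) :
    ∃ v : EuclideanSpace ℝ (Fin n) → V, StronglyMeasurable v ∧
      ∀ ℓ : StrongDual ℝ V, ‖ℓ‖ ≤ 1 → ∀ᵐ x ∂(volume.restrict Ω), ℓ (v x) = D ℓ x := by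
  let γ : EuclideanSpace ℝ (Fin n) → ℝ≥0 := fun x => (g x).toNNReal
  have hγ : Measurable γ := g.stronglyMeasurable.measurable.real_toNNReal
  let μ : Measure (EuclideanSpace ℝ (Fin n)) :=
    (volume.restrict Ω).withDensity fun x => (γ x : ℝ≥0∞)
  have hμac : μ ≪ volume.restrict Ω := withDensity_absolutelyContinuous _ _
  -- Where `g` vanishes, so does `D ℓ` almost everywhere, and the value 0 of the quotient is the
  -- right one.
  let d : StrongDual ℝ V → EuclideanSpace ℝ (Fin n) → ℝ := fun ℓ x => D ℓ x / g x
  have hγd : ∀ ℓ : StrongDual ℝ V, ‖ℓ‖ ≤ 1 →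
      ∀ᵐ x ∂(volume.restrict Ω), (γ x : ℝ) * d ℓ x = D ℓ x := by
    intro ℓ hℓ
    filter_upwards [hDg ℓ hℓ] with x hx
    have hg0 : 0 ≤ g x := (abs_nonneg _).trans hx
    change ((g x).toNNReal : ℝ) * (D ℓ x / g x) = D ℓ x
    rw [Real.coe_toNNReal _ hg0]
    rcases hg0.eq_or_lt with h0 | h0
    · rw [← h0, abs_nonpos_iff] at hx
      simp [hx]
    · field_simp
  have hdm : ∀ ℓ : StrongDual ℝ V, ‖ℓ‖ ≤ 1 → AEStronglyMeasurable (d ℓ) μ := fun ℓ _ =>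
    ((D ℓ).stronglyMeasurable.measurable.div
      g.stronglyMeasurable.measurable).aestronglyMeasurable
  have hdb : ∀ ℓ : StrongDual ℝ V, ‖ℓ‖ ≤ 1 → ∀ᵐ x ∂μ, |d ℓ x| ≤ 1 := by
    intro ℓ hℓ
    filter_upwards [hμac.ae_le (hDg ℓ hℓ)] with x hx
    change |D ℓ x / g x| ≤ 1
    rw [abs_div]
    exact div_le_one_of_le₀ (hx.trans (le_abs_self _)) (abs_nonneg _)
  have hμint : ∀ F : EuclideanSpace ℝ (Fin n) → ℝ, ∀ ℓ : StrongDual ℝ V, ‖ℓ‖ ≤ 1 →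
      ∫ x, F x * d ℓ x ∂μ = ∫ x in Ω, F x * D ℓ x := by
    intro F ℓ hℓ
    rw [integral_withDensity_eq_integral_smul hγ]
    refine integral_congr_ae ?_
    filter_upwards [hγd ℓ hℓ] with x hx
    rw [NNReal.smul_def, smul_eq_mul, mul_left_comm, hx]
  have hμΩ : μ Ωᶜ = 0 := hμac (by simp [hΩ.measurableSet])
  have hμK : ∀ K ⊆ Ω, IsCompact K → μ K < ∞ := by
    intro K hKΩ hK
    have h1 := (hg.integrableOn_compact_subset hKΩ hK).2
    rw [HasFiniteIntegral] at h1
    rw [withDensity_apply _ hK.measurableSet, Measure.restrict_restrict hK.measurableSet,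
      inter_eq_left.2 hKΩ]
    refine lt_of_le_of_lt (lintegral_mono fun x => ?_) h1
    exact Real.ofReal_le_enorm (g x)
  -- every set of finite measure represents a vector
  have hrep : ∀ A, MeasurableSet A → μ A < ∞ →
      ∃ y : V, ∀ ℓ : StrongDual ℝ V, ‖ℓ‖ ≤ 1 → ℓ y = ∫ x in A, d ℓ x ∂μ := by
    intro A hA hμA
    have hF : Integrable (A.indicator fun _ => (1 : ℝ)) μ :=
      (integrable_indicator_iff hA).2 (integrableOn_const hμA.ne)
    obtain ⟨y, hy⟩ := exists_dual_eq_integral_mul_of_forall_approx zero_le_one hdm hdb hF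
      fun ε hε => by
        obtain ⟨φ, hφ, hφc, hφΩ, hφi, hlt⟩ :=
          exists_contDiff_integral_abs_indicator_sub_lt hΩ hμΩ hμK hA hμA hε
        -- The weak derivative of `⟨ℓ, u⟩`, integrated against `φ`, is `ℓ` applied to this vector,
        -- which does not depend on `ℓ`.
        refine ⟨φ, hφi, hlt, -∫ x in Ω, (fderiv ℝ φ x (EuclideanSpace.single j 1)) • u x,
          fun ℓ hℓ => ?_⟩
        have hd : Continuous fun x => fderiv ℝ φ x (EuclideanSpace.single j 1) :=
          (hφ.continuous_fderiv (by simp)).clm_apply continuous_const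
        rw [hμint φ ℓ hℓ, map_neg, ← ℓ.integral_comp_comm (integrableOn_smul_of_tsupport_subset hd
          (hφc.fderiv_apply ℝ _) ((tsupport_fderiv_apply_subset ℝ _).trans hφΩ) hu)]
        have h := (hD ℓ hℓ).2.2 φ hφ hφc hφΩ
        simp only [smul_eq_mul] at h
        rw [eq_neg_iff_add_eq_zero, add_comm, ← eq_neg_iff_add_eq_zero] at h
        rw [h]
        congr 1
        refine integral_congr_ae ?_
        filter_upwards [coeFn_pairing ℓ u] with x hx
        simp [hx]
    refine ⟨y, fun ℓ hℓ => ?_⟩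
    rw [hy ℓ hℓ, ← integral_indicator hA]
    congr 1 with x
    by_cases hx : x ∈ A <;> simp [hx]
  -- pass to an equivalent finite measure
  obtain ⟨ω, hω0, hωm, hωlt⟩ := exists_pos_lintegral_lt_of_sigmaFinite μ one_ne_zero
  let κ : Measure (EuclideanSpace ℝ (Fin n)) := μ.withDensity fun x => (ω x : ℝ≥0∞)
  have hκ : IsFiniteMeasure κ := isFiniteMeasure_withDensity (hωlt.trans ENNReal.one_lt_top).ne
  have hκac : κ ≪ μ := withDensity_absolutelyContinuous _ _
  have hμκ : μ ≪ κ := withDensity_absolutelyContinuous' hωm.coe_nnreal_ennreal.aemeasurable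
    (Eventually.of_forall fun x => by simpa using (hω0 x).ne')
  have hωint : Integrable (fun x => (ω x : ℝ)) μ := by
    refine ⟨hωm.coe_nnreal_real.aestronglyMeasurable, ?_⟩
    rw [HasFiniteIntegral]
    simpa using hωlt.trans ENNReal.one_lt_top
  obtain ⟨f, hf, hfd⟩ := hV.exists_integrable_dual_ae_eq κ (d := d)
    (fun ℓ hℓ => (hdm ℓ hℓ).mono_ac hκac) (fun ℓ hℓ => hκac.ae_le (hdb ℓ hℓ)) fun A hA => by
      obtain ⟨y, hy⟩ := exists_dual_eq_integral_mul zero_le_one hdm hdb hrep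
        (hωint.indicator hA)
      refine ⟨y, fun ℓ hℓ => ?_⟩
      rw [hy ℓ hℓ, setIntegral_withDensity_eq_setIntegral_smul hωm _ hA, ← integral_indicator hA]
      congr 1 with x
      by_cases hx : x ∈ A <;> simp [hx, NNReal.smul_def]
  have hfμ : AEStronglyMeasurable f μ := hf.1.mono_ac hμκ
  -- Multiplying by `γ` undoes the division by `g`. The density is controlled only `μ`-a.e., which
  -- suffices because the product is 0 where `γ` is.
  refine ⟨fun x => (γ x : ℝ) • hfμ.mk f x,
    hγ.coe_nnreal_real.stronglyMeasurable.smul hfμ.stronglyMeasurable_mk, fun ℓ hℓ => ?_⟩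
  have h1 : ∀ᵐ x ∂μ, ℓ (hfμ.mk f x) = d ℓ x := by
    filter_upwards [hμκ.ae_le (hfd ℓ hℓ), hfμ.ae_eq_mk] with x hx hx'
    rw [← hx', hx]
  rw [ae_withDensity_iff hγ.coe_nnreal_ennreal] at h1
  filter_upwards [h1, hγd ℓ hℓ] with x hx hx'
  rw [map_smul, smul_eq_mul, ← hx']
  rcases eq_or_ne (γ x) 0 with h0 | h0
  · simp [h0]
  · rw [hx (by simpa using h0)]

/-- The candidate derivative is known only through functionals. That is enough both for the bound
`‖v‖ ≤ g`, which places it in X(Ω; V), and for the integration by parts. -/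
theorem HasRadonNikodymProperty.reshetnyakR_subset_sobolevW
    (hV : HasRadonNikodymProperty.{v, w} V) (hΩ : IsOpen Ω) (X : BanachFunctionSpace Ω) :
    reshetnyakR X V ⊆ sobolevW X V := by
  rintro u ⟨hu, -, g, hg0, hgX, hg⟩
  refine ⟨hu, fun j => ?_⟩
  have hg' : ∀ ℓ : StrongDual ℝ V, ∃ D : MeasFun Ω ℝ, ‖ℓ‖ ≤ 1 →
      IsWeakPartialDeriv j (pairing ℓ u) D ∧ ∀ᵐ x ∂(volume.restrict Ω), |D x| ≤ g x := by
    intro ℓ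
    by_cases hℓ : ‖ℓ‖ ≤ 1
    · obtain ⟨d, hd, hdg⟩ := hg ℓ hℓ
      refine ⟨d j, fun _ => ⟨hd j, ?_⟩⟩
      filter_upwards [hdg] with x hx
      refine le_trans ?_ hx
      rw [← Real.norm_eq_abs, ← Real.sqrt_sq (norm_nonneg (d j x))]
      exact Real.sqrt_le_sqrt (Finset.single_le_sum (f := fun i => ‖d i x‖ ^ 2)
        (fun i _ => sq_nonneg _) (Finset.mem_univ j))
    · exact ⟨0, fun h => absurd h hℓ⟩
  choose D hD using hg'
  have hul := locallyIntegrableOn_of_mem_vectorSpaceX hΩ hu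
  obtain ⟨v, hvm, hv⟩ := hV.exists_dual_ae_eq_weakPartialDeriv hΩ hul
    (locallyIntegrableOn_of_nrm_lt_top hΩ hg0 hgX)
    (fun ℓ hℓ => (hD ℓ hℓ).1) (fun ℓ hℓ => (hD ℓ hℓ).2)
  let v' : MeasFun Ω V := AEEqFun.mk v hvm.aestronglyMeasurable
  have hv' : ∀ ℓ : StrongDual ℝ V, ‖ℓ‖ ≤ 1 → ∀ᵐ x ∂(volume.restrict Ω), ℓ (v' x) = D ℓ x := by
    intro ℓ hℓ
    filter_upwards [hv ℓ hℓ, AEEqFun.coeFn_mk v hvm.aestronglyMeasurable] with x hx hx'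
    rw [hx', hx]
  have hvX : v' ∈ vectorSpaceX X V := by
    refine mem_vectorSpaceX_of_ae_norm_le hgX
      (ae_norm_le_of_forall_dual_le v'.aestronglyMeasurable fun ℓ hℓ => ?_)
    filter_upwards [hv' ℓ hℓ, (hD ℓ hℓ).2] with x hx hx'
    exact hx.le.trans ((le_abs_self _).trans hx')
  have hvl := locallyIntegrableOn_of_mem_vectorSpaceX hΩ hvX
  refine ⟨v', hvX, hul, hvl, fun φ hφ hφc hφΩ => eq_of_forall_dual_eq fun ℓ hℓ => ?_⟩
  have hd : Continuous fun x => fderiv ℝ φ x (EuclideanSpace.single j 1) :=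
    (hφ.continuous_fderiv (by simp)).clm_apply continuous_const
  rw [map_neg, ← ℓ.integral_comp_comm (integrableOn_smul_of_tsupport_subset hd
    (hφc.fderiv_apply ℝ _) ((tsupport_fderiv_apply_subset ℝ _).trans hφΩ) hul),
    ← ℓ.integral_comp_comm (integrableOn_smul_of_tsupport_subset hφ.continuous hφc hφΩ hvl)]
  convert (hD ℓ hℓ).1.2.2 φ hφ hφc hφΩ using 1
  · refine integral_congr_ae ?_
    filter_upwards [coeFn_pairing ℓ u] with x hx
    simp [hx]
  · congr 1
    refine integral_congr_ae ?_
    filter_upwards [hv' ℓ hℓ] with x hx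
    simp [hx]

end Reshetnyak

/-! ### Increments of closed vector-valued martingales -/

section Martingale

variable {α : Type*} {m0 : MeasurableSpace α} {μ : Measure α} {V : Type*} [NormedAddCommGroup V]
  [NormedSpace ℝ V] [CompleteSpace V]

/-- The increments of a closed vector-valued martingale tend to zero in `L¹`. -/
theorem tendsto_eLpNorm_condExp_succ_sub [IsFiniteMeasure μ] (ℱ : Filtration ℕ m0) {h : α → V}
    (hh : Integrable h μ) :
    Tendsto (fun k => eLpNorm (μ[h | ℱ (k + 1)] - μ[h | ℱ k]) 1 μ) atTop (𝓝 0) := by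
  -- For an indicator times a vector the claim reduces to scalar L¹ martingale convergence. It
  -- extends to all integrable functions because conditional expectation contracts L¹.
  refine Integrable.induction (μ := μ) (P := fun h : α → V =>
    Tendsto (fun k => eLpNorm (μ[h | ℱ (k + 1)] - μ[h | ℱ k]) 1 μ) atTop (𝓝 0)) ?_ ?_ ?_ ?_ hh
  · intro y s hs _
    let ψ : α → ℝ := s.indicator fun _ => 1
    have hψ : Integrable ψ μ := (integrable_const 1).indicator hs
    let T : ℝ →L[ℝ] V := ContinuousLinearMap.toSpanSingleton ℝ y
    have hT : (s.indicator fun _ => y) = T ∘ ψ := by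
      ext x
      by_cases hx : x ∈ s <;> simp [hx, T, ψ]
    have hlim := tendsto_eLpNorm_condExp (μ := μ) (ℱ := ℱ) ψ
    have hreal : Tendsto (fun k => eLpNorm (μ[ψ | ℱ (k + 1)] - μ[ψ | ℱ k]) 1 μ) atTop (𝓝 0) := by
      have h2 := ((tendsto_add_atTop_iff_nat 1).2 hlim).add hlim
      rw [add_zero] at h2
      refine tendsto_of_tendsto_of_tendsto_of_le_of_le tendsto_const_nhds h2
        (fun _ => zero_le) fun k => ?_
      have hint : ∀ m : MeasurableSpace α, AEStronglyMeasurable[m0] (μ[ψ | m]) μ := fun m =>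
        integrable_condExp.aestronglyMeasurable
      refine le_trans (le_of_eq ?_) (eLpNorm_sub_le
        (f := μ[ψ | ℱ (k + 1)] - μ[ψ | ⨆ n, ℱ n]) (g := μ[ψ | ℱ k] - μ[ψ | ⨆ n, ℱ n])
        ((hint _).sub (hint _)) ((hint _).sub (hint _)) le_rfl)
      rw [sub_sub_sub_cancel_right]
    have hle : ∀ k, eLpNorm (μ[s.indicator fun _ => y | ℱ (k + 1)] -
        μ[s.indicator fun _ => y | ℱ k]) 1 μ ≤
        ENNReal.ofReal ‖y‖ * eLpNorm (μ[ψ | ℱ (k + 1)] - μ[ψ | ℱ k]) 1 μ := by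
      intro k
      refine eLpNorm_le_mul_eLpNorm_of_ae_le_mul ?_ 1
      rw [hT]
      filter_upwards [T.comp_condExp_comm (m := ℱ (k + 1)) hψ, T.comp_condExp_comm (m := ℱ k) hψ]
        with x h1 h2
      rw [Pi.sub_apply, Pi.sub_apply, ← h1, ← h2, Function.comp_apply, Function.comp_apply,
        ← map_sub, ContinuousLinearMap.toSpanSingleton_apply, norm_smul, mul_comm]
    refine tendsto_of_tendsto_of_tendsto_of_le_of_le tendsto_const_nhds ?_
      (fun _ => zero_le) hle
    simpa using ENNReal.Tendsto.const_mul (a := ENNReal.ofReal ‖y‖) hreal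
      (Or.inr ENNReal.ofReal_ne_top)
  · intro f g _ hf hg hf' hg'
    have h2 := hf'.add hg'
    rw [add_zero] at h2
    refine tendsto_of_tendsto_of_tendsto_of_le_of_le tendsto_const_nhds h2
      (fun _ => zero_le) fun k => ?_
    have hint : ∀ (m : MeasurableSpace α) (f : α → V), AEStronglyMeasurable[m0] (μ[f | m]) μ :=
      fun m f => integrable_condExp.aestronglyMeasurable
    refine le_trans (le_of_eq (eLpNorm_congr_ae ?_)) (eLpNorm_add_le
      ((hint _ f).sub (hint _ f)) ((hint _ g).sub (hint _ g)) le_rfl)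
    filter_upwards [condExp_add hf hg (ℱ (k + 1)), condExp_add hf hg (ℱ k)] with x h1 h2
    simp only [Pi.sub_apply, Pi.add_apply, h1, h2]
    abel
  · refine isClosed_of_closure_subset fun f hf => ?_
    rw [mem_ofPred_eq, ENNReal.tendsto_atTop_zero]
    intro ε hε
    obtain ⟨δ, hδ, hδε⟩ := ENNReal.lt_iff_exists_nnreal_btwn.1 hε
    have hδ' : (0 : ℝ) < δ := by simpa using hδ
    obtain ⟨g, hg, hfg⟩ := Metric.mem_closure_iff.1 hf (δ / 3) (by positivity)
    have hg' := ENNReal.tendsto_atTop_zero.1 hg (ENNReal.ofReal (δ / 3)) (by simpa using hδ')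
    obtain ⟨N, hN⟩ := hg'
    refine ⟨N, fun k hk => ?_⟩
    have hfi := L1.integrable_coeFn f
    have hgi := L1.integrable_coeFn g
    have hdiff : eLpNorm (⇑f - ⇑g) 1 μ ≤ ENNReal.ofReal (δ / 3) := by
      rw [Lp.dist_def] at hfg
      exact (ENNReal.le_ofReal_iff_toReal_le ((memLp_one_iff_integrable.2
        (hfi.sub hgi)).2.ne) (by positivity)).2 hfg.le
    have hm : ∀ (m : MeasurableSpace α) (f : α → V), AEStronglyMeasurable[m0] (μ[f | m]) μ :=
      fun m f => integrable_condExp.aestronglyMeasurable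
    have hc : ∀ m : MeasurableSpace α, eLpNorm (μ[⇑f - ⇑g | m]) 1 μ ≤ ENNReal.ofReal (δ / 3) :=
      fun m => (eLpNorm_condExp_le_eLpNorm _ le_rfl).trans hdiff
    have heq : μ[⇑f | ℱ (k + 1)] - μ[⇑f | ℱ k] =ᵐ[μ]
        (μ[⇑g | ℱ (k + 1)] - μ[⇑g | ℱ k]) +
          (μ[⇑f - ⇑g | ℱ (k + 1)] - μ[⇑f - ⇑g | ℱ k]) := by
      filter_upwards [condExp_sub hfi hgi (ℱ (k + 1)), condExp_sub hfi hgi (ℱ k)] with x h1 h2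
      simp only [Pi.sub_apply, Pi.add_apply, h1, h2]
      abel
    rw [eLpNorm_congr_ae heq]
    refine ((eLpNorm_add_le ((hm _ _).sub (hm _ _)) ((hm _ _).sub (hm _ _)) le_rfl).trans
      (add_le_add (hN k hk) ((eLpNorm_sub_le (hm _ _) (hm _ _) le_rfl).trans
        (add_le_add (hc _) (hc _))))).trans ?_
    rw [← ENNReal.ofReal_add (by positivity) (by positivity),
      ← ENNReal.ofReal_add (by positivity) (by positivity)]
    refine le_trans (le_of_eq ?_) hδε.le
    rw [show (δ : ℝ) / 3 + (δ / 3 + δ / 3) = δ by ring, ENNReal.ofReal_coe_nnreal]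
  · intro f g hfg _ hf
    refine hf.congr fun k => eLpNorm_congr_ae ?_
    filter_upwards [condExp_congr_ae (m := ℱ (k + 1)) hfg, condExp_congr_ae (m := ℱ k) hfg]
      with x h1 h2
    rw [Pi.sub_apply, Pi.sub_apply, h1, h2]

end Martingale

/-! ### Densities on finite spaces -/

section FiniteDensity

variable {Z : Type*} [Finite Z] [MeasurableSpace Z] [MeasurableSingletonClass Z]
  {V : Type*} [NormedAddCommGroup V] [NormedSpace ℝ V]

/-- The density of a vector measure on a finite space. -/
def finiteDensity (m : Measure Z) (N : VectorMeasure Z V) (z : Z) : V := (m.real {z})⁻¹ • N {z}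

/-- The integral is a finite sum over points; points of mass 0 contribute nothing on either side, by
`hN`. -/
theorem setIntegral_finiteDensity [CompleteSpace V] (m : Measure Z) [IsFiniteMeasure m]
    (N : VectorMeasure Z V) (hN : ∀ z, m {z} = 0 → N {z} = 0) (B : Set Z) :
    ∫ z in B, finiteDensity m N z ∂m = N B := by
  classical
  have := Fintype.ofFinite Z
  have hB : B = ⋃ z ∈ B.toFinset, {z} := by ext; simp
  have hint : Integrable (finiteDensity m N) m := .of_finite
  rw [← coe_toFinset B, setIntegral_finset _ hint.integrableOn, coe_toFinset]
  conv_rhs => rw [hB]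
  rw [VectorMeasure.of_biUnion_finset (by simp [Set.PairwiseDisjoint, Set.Pairwise, Function.onFun])
    fun _ _ => measurableSet_singleton _]
  refine Finset.sum_congr rfl fun z _ => ?_
  by_cases hz : m {z} = 0
  · simp [finiteDensity, hN z hz]
  · rw [finiteDensity, smul_inv_smul₀]
    rw [measureReal_def, ENNReal.toReal_ne_zero]
    exact ⟨hz, measure_ne_top _ _⟩

end FiniteDensity

/-! ### Densities on finite algebras and their L¹ limit -/

section Density

variable {α : Type w} [MeasurableSpace α] {V : Type*} [NormedAddCommGroup V]
  [NormedSpace ℝ V]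

/-- The membership pattern of a point with respect to a family of measurable sets. -/
def membershipPattern {ι : Type*} (A : ι → {A : Set α // MeasurableSet A}) (x : α) : ι → Prop :=
  fun i => x ∈ (A i).1

theorem measurable_membershipPattern {ι : Type*} (A : ι → {A : Set α // MeasurableSet A}) :
    Measurable (membershipPattern A) :=
  measurable_pi_iff.2 fun i => measurable_mem.2 (A i).2

/-- The membership pattern of a point with respect to finitely many measurable sets. -/
def finsetPattern (s : Finset {A : Set α // MeasurableSet A}) : α → s → Prop :=
  membershipPattern Subtype.val

theorem measurable_finsetPattern (s : Finset {A : Set α // MeasurableSet A}) :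
    Measurable (finsetPattern s) :=
  measurable_membershipPattern _

/-- The density of a vector measure on the finite algebra generated by finitely many sets. -/
def partitionDensity (μ : Measure α) (ν : VectorMeasure α V)
    (s : Finset {A : Set α // MeasurableSet A}) : (s → Prop) → V :=
  finiteDensity (μ.map (finsetPattern s)) (ν.map (finsetPattern s))

variable {μ : Measure α} [IsFiniteMeasure μ] {ν : VectorMeasure α V}

/-- Only the law of `r` enters, so this serves both for the pattern map on `α` and for its copy on a
coupled space. -/
theorem setIntegral_partitionDensity [CompleteSpace V]
    (hν : ∀ A, MeasurableSet A → μ A = 0 → ν A = 0)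
    (s : Finset {A : Set α // MeasurableSet A}) {Ω : Type*} [MeasurableSpace Ω]
    {P : Measure Ω} {r : Ω → (s → Prop)} (hr : Measurable r)
    (hrP : P.map r = μ.map (finsetPattern s)) (B : Set (s → Prop)) :
    ∫ x in r ⁻¹' B, partitionDensity μ ν s (r x) ∂P =
      ν (finsetPattern s ⁻¹' B) := by
  have hB : MeasurableSet B := B.toFinite.measurableSet
  have hc := measurable_finsetPattern s
  rw [← setIntegral_map (f := partitionDensity μ ν s) hB
    (StronglyMeasurable.of_discrete).aestronglyMeasurable hr.aemeasurable, hrP,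
    partitionDensity, setIntegral_finiteDensity, VectorMeasure.map_apply _ hc hB]
  intro z hz
  have hzm := measurableSet_singleton z
  rw [Measure.map_apply hc hzm] at hz
  rw [VectorMeasure.map_apply _ hc hzm]
  exact hν _ (hc hzm) hz

theorem integrable_partitionDensity (s : Finset {A : Set α // MeasurableSet A}) :
    Integrable (fun x => partitionDensity μ ν s (finsetPattern s x)) μ := by
  have h : Integrable (partitionDensity μ ν s) (μ.map (finsetPattern s)) := .of_finite
  exact h.comp_measurable (measurable_finsetPattern s)

/-- A vector measure `ν` has an integrable density, provided that every measurable map `c` into a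
standard Borel space admits a coupling with a probability space on which the image of `ν` under `c`
has an integrable density. -/
theorem exists_integrable_density_of_coupling [CompleteSpace V]
    (hν : ∀ A, MeasurableSet A → μ A = 0 → ν A = 0)
    (hcoupling : ∀ (Y : Type w) [MeasurableSpace Y] [StandardBorelSpace Y] (c : α → Y),
      Measurable c → ∃ (Ω : Type) (_ : MeasurableSpace Ω) (P : Measure Ω) (r : Ω → Y) (h : Ω → V),
        IsFiniteMeasure P ∧ Measurable r ∧ P.map r = μ.map c ∧ Integrable h P ∧
        ∀ D, MeasurableSet D → ∫ x in r ⁻¹' D, h x ∂P = ν (c ⁻¹' D)) :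
    ∃ f : α → V, Integrable f μ ∧ ∀ A, MeasurableSet A → ν A = ∫ x in A, f x ∂μ := by
  classical
  let f : Finset {A : Set α // MeasurableSet A} → α → V := fun s x =>
    partitionDensity μ ν s (finsetPattern s x)
  have hf : ∀ s, Integrable (f s) μ := integrable_partitionDensity
  have hcauchy : ∀ ε > 0, ∃ s, ∀ t, s ≤ t → eLpNorm (f t - f s) 1 μ < ε := by
    -- Otherwise an increasing sequence of finite families has increments of L¹ norm at least `ε`.
    -- It involves countably many sets `U`, so the pattern map takes values in the standard Borel
    -- space `U → Prop`.
    by_contra! hcon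
    obtain ⟨ε, hε, hcon⟩ := hcon
    choose nxt hnxt hfar using hcon
    let s : ℕ → Finset {A : Set α // MeasurableSet A} := fun k => nxt^[k] ∅
    have hs1 : ∀ k, s (k + 1) = nxt (s k) := fun k => Function.iterate_succ_apply' nxt k ∅
    have hsmono : Monotone s := monotone_nat_of_le_succ fun k => by
      rw [hs1]
      exact hnxt _
    let U : Set {A : Set α // MeasurableSet A} := ⋃ k, (s k : Set _)
    have hU : U.Countable := countable_iUnion fun k => (s k).countable_toSet
    have : Countable U := hU.to_subtype
    have hsU : ∀ k, ∀ A : s k, A.1 ∈ U := fun k A => mem_iUnion.2 ⟨k, A.2⟩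
    let c : α → U → Prop := membershipPattern Subtype.val
    have hc : Measurable c := measurable_membershipPattern _
    obtain ⟨Ω, _, P, r, h, _, hr, hrP, hh, hhν⟩ := hcoupling (U → Prop) c hc
    let p : ∀ k, (U → Prop) → (s k → Prop) := fun k y A => y ⟨A.1, hsU k A⟩
    have hp : ∀ k, Measurable (p k) := fun k => measurable_pi_iff.2 fun A => measurable_pi_apply _
    have hpc : ∀ k, p k ∘ c = finsetPattern (s k) := fun k => rfl
    let ℱ : Filtration ℕ ‹MeasurableSpace Ω› :=
      { seq := fun k => MeasurableSpace.comap (p k ∘ r) inferInstance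
        mono' := monotone_nat_of_le_succ fun k => by
          let q : (s (k + 1) → Prop) → (s k → Prop) := fun y A => y ⟨A.1, hsmono k.le_succ A.2⟩
          have hq : Measurable q := measurable_pi_iff.2 fun A => measurable_pi_apply _
          have : p k ∘ r = q ∘ (p (k + 1) ∘ r) := rfl
          rw [this, ← MeasurableSpace.comap_comp]
          exact MeasurableSpace.comap_mono hq.comap_le
        le' := fun k => ((hp k).comp hr).comap_le }
    have hlaw : ∀ k, P.map (p k ∘ r) = μ.map (finsetPattern (s k)) := fun k => by
      rw [← Measure.map_map (hp k) hr, hrP, Measure.map_map (hp k) hc, hpc]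
    -- On the coupled space, the copies of the finite densities are the martingale closed by `h`.
    have hcond : ∀ k, (fun x => partitionDensity μ ν (s k) (p k (r x))) =ᵐ[P] P[h | ℱ k] := by
      intro k
      have hint : Integrable (fun x => partitionDensity μ ν (s k) (p k (r x))) P := by
        have hi : Integrable (partitionDensity μ ν (s k)) (P.map (p k ∘ r)) := by
          rw [hlaw]
          exact .of_finite
        exact hi.comp_measurable ((hp k).comp hr)
      refine ae_eq_condExp_of_forall_setIntegral_eq (ℱ.le k) hh (fun _ _ _ => hint.integrableOn)
        ?_ ?_
      · rintro _ ⟨B, hB, rfl⟩ _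
        rw [preimage_comp, hhν _ (hp k hB)]
        exact setIntegral_partitionDensity hν (s k) ((hp k).comp hr) (hlaw k) B
      · exact ((StronglyMeasurable.of_discrete (f := partitionDensity μ ν (s k))).comp_measurable
          (comap_measurable (p k ∘ r))).aestronglyMeasurable
    have hlim := tendsto_eLpNorm_condExp_succ_sub ℱ hh
    obtain ⟨k, hk⟩ := ((tendsto_order.1 hlim).2 ε hε).exists
    refine absurd hk (not_lt.2 ((hfar (s k)).trans (le_of_eq ?_)))
    rw [← hs1]
    -- The increment is a function of the pattern, and `c` and `r` have the same law, so its L¹ norm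
    -- is the same on both spaces.
    let F : (U → Prop) → V := (partitionDensity μ ν (s (k + 1))) ∘ p (k + 1) -
      (partitionDensity μ ν (s k)) ∘ p k
    have hF : StronglyMeasurable F :=
      ((StronglyMeasurable.of_discrete (f := partitionDensity μ ν (s (k + 1)))).comp_measurable
        (hp _)).sub ((StronglyMeasurable.of_discrete (f := partitionDensity μ ν (s k))).comp_measurable
          (hp _))
    have h1 : f (s (k + 1)) - f (s k) = F ∘ c := rfl
    have h2 : (P[h | ℱ (k + 1)] - P[h | ℱ k]) =ᵐ[P] F ∘ r := ((hcond (k + 1)).sub (hcond k)).symm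
    rw [h1, eLpNorm_congr_ae h2, ← eLpNorm_map_measure hF.aestronglyMeasurable hc.aemeasurable,
      ← eLpNorm_map_measure hF.aestronglyMeasurable hr.aemeasurable, hrP]
  have hL : CauchySeq fun s => (hf s).toL1 (f s) := by
    rw [Metric.cauchySeq_iff']
    intro ε hε
    obtain ⟨s, hs⟩ := hcauchy (ENNReal.ofReal ε) (by simpa using hε)
    refine ⟨s, fun t ht => ?_⟩
    rw [dist_eq_norm, ← Integrable.toL1_sub, Integrable.norm_toL1]
    simp only [edist_zero_right]
    rw [← eLpNorm_one_eq_lintegral_enorm]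
    exact ENNReal.toReal_lt_of_lt_ofReal (hs t ht)
  obtain ⟨g, hg⟩ := cauchySeq_tendsto_of_complete hL
  refine ⟨g, L1.integrable_coeFn g, fun A hA => ?_⟩
  have h1 : Tendsto (fun s => ∫ x in A, (hf s).toL1 (f s) x ∂μ) atTop (𝓝 (∫ x in A, g x ∂μ)) :=
    ((continuous_setIntegral A).tendsto g).comp hg
  refine tendsto_nhds_unique (tendsto_const_nhds.congr' ?_) h1
  -- Once `A` belongs to `s` it is a union of cells, so the integral over `A` already equals `ν A`.
  filter_upwards [eventually_ge_atTop {⟨A, hA⟩}] with s hs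
  rw [setIntegral_congr_ae hA ((hf s).coeFn_toL1.mono fun x hx _ => hx)]
  have hAs : (⟨A, hA⟩ : {A : Set α // MeasurableSet A}) ∈ s := hs (Finset.mem_singleton_self _)
  exact (setIntegral_partitionDensity hν s (measurable_finsetPattern s) rfl
    {y | y ⟨_, hAs⟩}).symm

end Density

/-! ### Lipschitz functions belong to R¹X -/

section Lipschitz

variable {n : ℕ} {Ω : Set (EuclideanSpace ℝ (Fin n))}

theorem setIntegral_smul_mk {ψ f : EuclideanSpace ℝ (Fin n) → ℝ} (hψ : tsupport ψ ⊆ Ω)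
    (hf : AEStronglyMeasurable f (volume.restrict Ω)) :
    ∫ x in Ω, ψ x • (AEEqFun.mk f hf : MeasFun Ω ℝ) x = ∫ x, ψ x * f x := by
  rw [← setIntegral_eq_integral_of_forall_compl_eq_zero (s := Ω) (f := fun x => ψ x * f x)]
  · refine integral_congr_ae ?_
    filter_upwards [AEEqFun.coeFn_mk f hf] with x hx
    rw [hx, smul_eq_mul]
  · intro x hx
    rw [image_eq_zero_of_notMem_tsupport fun h => hx (hψ h), zero_mul]

/-- The line derivatives of a real-valued Lipschitz function are its weak partial derivatives. -/
theorem isWeakPartialDeriv_lineDeriv {f : EuclideanSpace ℝ (Fin n) → ℝ} {C : ℝ≥0}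
    (hf : LipschitzWith C f) (j : Fin n) :
    IsWeakPartialDeriv j
      (AEEqFun.mk f hf.continuous.aestronglyMeasurable : MeasFun Ω ℝ)
      (AEEqFun.mk (fun x => lineDeriv ℝ f x (EuclideanSpace.single j 1))
        (stronglyMeasurable_lineDeriv hf.continuous).aestronglyMeasurable) := by
  have h1 : LocallyIntegrableOn f Ω :=
    (hf.continuous.locallyIntegrable).locallyIntegrableOn Ω
  have h2 : LocallyIntegrableOn (fun x => lineDeriv ℝ f x (EuclideanSpace.single j 1)) Ω :=
    (hf.locallyIntegrable_lineDeriv _).locallyIntegrableOn Ω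
  refine ⟨h1.congr (AEEqFun.coeFn_mk _ _).symm, h2.congr (AEEqFun.coeFn_mk _ _).symm,
    fun φ hφ hφc hφΩ => ?_⟩
  obtain ⟨D, hD⟩ := ContDiff.lipschitzWith_of_hasCompactSupport hφc hφ (by simp)
  have h3 := hf.integral_lineDeriv_mul_eq (μ := volume) hD hφc (EuclideanSpace.single j 1)
  simp only [mul_comm _ (φ _)] at h3
  rw [setIntegral_smul_mk ((tsupport_fderiv_apply_subset ℝ _).trans hφΩ),
    setIntegral_smul_mk hφΩ, h3, ← integral_neg]
  congr 1 with x
  rw [((hφ.differentiable (by simp)).differentiableAt).lineDeriv_eq_fderiv, map_neg, neg_mul,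
    neg_neg]

variable {V : Type*} [NormedAddCommGroup V] [NormedSpace ℝ V]

/-- Weak partial derivatives are unique. -/
theorem IsWeakPartialDeriv.unique [CompleteSpace V] (hΩ : IsOpen Ω) {j : Fin n}
    {u v v' : MeasFun Ω V} (h : IsWeakPartialDeriv j u v) (h' : IsWeakPartialDeriv j u v') :
    v = v' := by
  have hae : ∀ᵐ x ∂volume, x ∈ Ω → (v - v' : EuclideanSpace ℝ (Fin n) → V) x = 0 := by
    refine hΩ.ae_eq_zero_of_integral_contDiff_smul_eq_zero (h.2.1.sub h'.2.1)
      fun φ hφ hφc hφΩ => ?_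
    rw [← setIntegral_eq_integral_of_forall_compl_eq_zero (s := Ω) fun x hx => by
      rw [image_eq_zero_of_notMem_tsupport fun h => hx (hφΩ h), zero_smul]]
    simp only [Pi.sub_apply, smul_sub]
    rw [integral_sub
      (integrableOn_smul_of_tsupport_subset hφ.continuous hφc hφΩ h.2.1)
      (integrableOn_smul_of_tsupport_subset hφ.continuous hφc hφΩ h'.2.1), sub_eq_zero]
    exact neg_injective ((h.2.2 φ hφ hφc hφΩ).symm.trans (h'.2.2 φ hφ hφc hφΩ))
  refine AEEqFun.ext ?_
  filter_upwards [(ae_restrict_iff' hΩ.measurableSet).2 hae] with x hx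
  exact sub_eq_zero.1 hx

theorem pairing_mk {u : EuclideanSpace ℝ (Fin n) → V} (hu : Continuous u) (ℓ : StrongDual ℝ V) :
    pairing ℓ (AEEqFun.mk u hu.aestronglyMeasurable : MeasFun Ω V) =
      AEEqFun.mk (ℓ ∘ u) (ℓ.continuous.comp hu).aestronglyMeasurable :=
  AEEqFun.comp_mk _ _ _ _

/-- Lipschitz functions with compact support in `Ω` belong to the Reshetnyak–Sobolev space. -/
theorem mk_mem_reshetnyakR_of_lipschitzWith (X : BanachFunctionSpace Ω)
    {u : EuclideanSpace ℝ (Fin n) → V} {C : ℝ≥0} (hu : LipschitzWith C u)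
    (huc : HasCompactSupport u) (huΩ : tsupport u ⊆ Ω) :
    (AEEqFun.mk u hu.continuous.aestronglyMeasurable : MeasFun Ω V) ∈ reshetnyakR X V := by
  set K := tsupport u with hK
  have hKm : MeasurableSet K := (isClosed_tsupport u).measurableSet
  have hbdd : ∀ c : ℝ, X.nrm (c • indicatorFun Ω K hKm) < ∞ := fun c => by
    rw [X.nrm_smul]
    exact ENNReal.mul_lt_top enorm_lt_top
      (X.indicatorFun_mem K hKm huΩ huc.isCompact.measure_lt_top)
  have hind : ∀ c : ℝ, ∀ᵐ x ∂(volume.restrict Ω),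
      (c • indicatorFun Ω K hKm) x = K.indicator (fun _ => c) x := fun c => by
    filter_upwards [AEEqFun.coeFn_smul c (indicatorFun Ω K hKm), coeFn_indicatorFun (Ω := Ω) hKm]
      with x h1 h2
    rw [h1, Pi.smul_apply, h2]
    by_cases hx : x ∈ K <;> simp [hx]
  obtain ⟨M, hM⟩ := huc.exists_bound_of_continuous hu.continuous
  have huX : (AEEqFun.mk u hu.continuous.aestronglyMeasurable : MeasFun Ω V) ∈
      vectorSpaceX X V := by
    refine mem_vectorSpaceX_of_ae_norm_le (hbdd M) ?_
    filter_upwards [hind M, AEEqFun.coeFn_mk u (μ := volume.restrict Ω)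
      hu.continuous.aestronglyMeasurable] with x h1 h2
    rw [h1, h2]
    by_cases hx : x ∈ K
    · simpa [hx] using hM x
    · simp [hx, image_eq_zero_of_notMem_tsupport hx]
  have hlip : ∀ ℓ : StrongDual ℝ V, ‖ℓ‖ ≤ 1 → LipschitzWith C (ℓ ∘ u) := fun ℓ hℓ => by
    refine (ℓ.lipschitz.comp hu).weaken ?_
    exact mul_le_of_le_one_left zero_le hℓ
  have hder : ∀ ℓ : StrongDual ℝ V, ‖ℓ‖ ≤ 1 → ∀ (j : Fin n) x,
      |lineDeriv ℝ (ℓ ∘ u) x (EuclideanSpace.single j 1)| ≤ K.indicator (fun _ => (C : ℝ)) x := by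
    intro ℓ hℓ j x
    by_cases hx : x ∈ K
    · simpa [hx] using norm_lineDeriv_le_of_lipschitz ℝ (hlip ℓ hℓ) (x₀ := x)
        (v := EuclideanSpace.single j (1 : ℝ))
    · have h0 : ℓ ∘ u =ᶠ[𝓝 x] fun _ => 0 := by
        filter_upwards [(isClosed_tsupport u).isOpen_compl.mem_nhds hx] with y hy
        simp [image_eq_zero_of_notMem_tsupport hy]
      rw [h0.lineDeriv_eq]
      simp [hx, lineDeriv]
  have hdw : ∀ ℓ : StrongDual ℝ V, ∀ hℓ : ‖ℓ‖ ≤ 1, ∀ j,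
      IsWeakPartialDeriv j
        (pairing ℓ (AEEqFun.mk u hu.continuous.aestronglyMeasurable : MeasFun Ω V))
        (AEEqFun.mk (fun x => lineDeriv ℝ (ℓ ∘ u) x (EuclideanSpace.single j 1))
          (stronglyMeasurable_lineDeriv (hlip ℓ hℓ).continuous).aestronglyMeasurable) := by
    intro ℓ hℓ j
    rw [pairing_mk hu.continuous]
    exact isWeakPartialDeriv_lineDeriv (hlip ℓ hℓ) j
  -- Each of the `n` partial derivatives is at most `C` on `K` and 0 off it, and the Euclidean norm
  -- is at most the sum; hence the upper gradient `n * C` times the indicator of `K`.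
  refine ⟨huX, fun ℓ hℓ => ⟨pairing_mem_vectorSpaceX huX hℓ, fun j => ⟨_, ?_, hdw ℓ hℓ j⟩⟩,
    ((n : ℝ) * C) • indicatorFun Ω K hKm, ?_, hbdd _, fun ℓ hℓ => ⟨_, hdw ℓ hℓ, ?_⟩⟩
  · refine mem_vectorSpaceX_of_ae_norm_le (hbdd C) ?_
    filter_upwards [hind C, AEEqFun.coeFn_mk
      (fun x => lineDeriv ℝ (ℓ ∘ u) x (EuclideanSpace.single j 1)) (μ := volume.restrict Ω)
      (stronglyMeasurable_lineDeriv (hlip ℓ hℓ).continuous).aestronglyMeasurable] with x h1 h2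
    rw [h1, h2]
    exact hder ℓ hℓ j x
  · refine AEEqFun.coeFn_le.1 ?_
    filter_upwards [hind (n * C), AEEqFun.coeFn_zero
      (α := EuclideanSpace ℝ (Fin n)) (β := ℝ) (μ := volume.restrict Ω)] with x h1 h2
    rw [h1, h2]
    exact indicator_nonneg (fun _ _ => by positivity) x
  · filter_upwards [hind (n * C), ae_all_iff.2 fun j => AEEqFun.coeFn_mk
      (fun x => lineDeriv ℝ (ℓ ∘ u) x (EuclideanSpace.single j 1)) (μ := volume.restrict Ω)
      (stronglyMeasurable_lineDeriv (hlip ℓ hℓ).continuous).aestronglyMeasurable] with x h1 h2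
    rw [h1]
    simp only [h2]
    refine (Real.sqrt_le_sqrt (Finset.sum_sq_le_sq_sum_of_nonneg fun j _ => norm_nonneg _)).trans ?_
    rw [Real.sqrt_sq (Finset.sum_nonneg fun j _ => norm_nonneg _)]
    refine (Finset.sum_le_sum fun j _ => hder ℓ hℓ j x).trans ?_
    by_cases hx : x ∈ K <;> simp [hx]

end Lipschitz

/-! ### Cubes and their projection to an interval -/

section Cube

/-- The image of Lebesgue measure on a ball of radius `ρ` in `ℝ` under the affine map onto
the unit interval. -/
theorem map_volume_restrict_ball {a ρ : ℝ} (hρ : 0 < ρ) :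
    (volume.restrict (Metric.ball a ρ)).map (fun t => (2 * ρ)⁻¹ * (t - (a - ρ))) =
      ENNReal.ofReal (2 * ρ) • volume.restrict (Ioo (0 : ℝ) 1) := by
  have hpre : Metric.ball a ρ = (fun t => (2 * ρ)⁻¹ * (t - (a - ρ))) ⁻¹' Ioo (0 : ℝ) 1 := by
    ext t
    rw [Real.ball_eq_Ioo, mem_preimage, mem_Ioo, mem_Ioo, inv_mul_lt_one₀ (by positivity),
      mul_pos_iff_of_pos_left (by positivity)]
    constructor <;> rintro ⟨h1, h2⟩ <;> constructor <;> linarith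
  have hmeas : Measurable fun t : ℝ => (2 * ρ)⁻¹ * (t - (a - ρ)) := by fun_prop
  rw [hpre, ← Measure.restrict_map hmeas measurableSet_Ioo]
  have hcomp : (fun t : ℝ => (2 * ρ)⁻¹ * (t - (a - ρ))) =
      ((2 * ρ)⁻¹ * ·) ∘ (fun t => t - (a - ρ)) := rfl
  rw [hcomp, ← Measure.map_map (by fun_prop) (by fun_prop),
    (measurePreserving_sub_right volume (a - ρ)).map_eq,
    Real.map_volume_mul_left (by positivity), inv_inv, abs_of_pos (by positivity),
    Measure.restrict_smul]

/-- Every open neighbourhood of a point contains a cube that projects onto the unit interval,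
measures being preserved up to a constant. -/
theorem exists_cube_map_volume_restrict {n : ℕ} (i : Fin n) {x₀ : EuclideanSpace ℝ (Fin n)}
    {U : Set (EuclideanSpace ℝ (Fin n))} (hU : U ∈ 𝓝 x₀) :
    ∃ (Q : Set (EuclideanSpace ℝ (Fin n))) (ρ : ℝ) (c : ℝ≥0∞), IsOpen Q ∧ Q ⊆ U ∧ 0 < ρ ∧ c ≠ 0 ∧
      c ≠ ∞ ∧ (volume.restrict Q).map (fun x => (2 * ρ)⁻¹ * (x i - (x₀ i - ρ))) =
        c • volume.restrict (Ioo (0 : ℝ) 1) := by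
  have hcont : Continuous (fun y : Fin n → ℝ => (WithLp.toLp 2 y : EuclideanSpace ℝ (Fin n))) :=
    PiLp.continuous_toLp 2 _
  have hcont' : Continuous (fun x : EuclideanSpace ℝ (Fin n) => (WithLp.ofLp x : Fin n → ℝ)) :=
    PiLp.continuous_ofLp 2 _
  obtain ⟨ρ, hρ, hball⟩ := Metric.mem_nhds_iff.1
    (hcont.continuousAt (x := WithLp.ofLp x₀) hU)
  let B : Set (Fin n → ℝ) := Metric.ball (WithLp.ofLp x₀) ρ
  have hmp' : MeasurePreserving
      (fun x : EuclideanSpace ℝ (Fin n) => (WithLp.ofLp x : Fin n → ℝ)) :=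
    PiLp.volume_preserving_ofLp (Fin n)
  have hQ := hmp'.restrict_preimage (s := B) measurableSet_ball
  have hs : Measurable fun t : ℝ => (2 * ρ)⁻¹ * (t - (x₀ i - ρ)) := by fun_prop
  -- The sup-norm ball `B` is a product of intervals. The constant is its volume: the other sides
  -- are integrated out, and rescaling side `i` to unit length gives `2 * ρ`.
  refine ⟨(fun x => WithLp.ofLp x) ⁻¹' B, ρ,
    (∏ j ∈ Finset.univ.erase i, volume.restrict (Metric.ball (x₀ j) ρ) univ) *
      ENNReal.ofReal (2 * ρ), Metric.isOpen_ball.preimage hcont',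
    fun x hx => hball hx, hρ, ?_, ?_, ?_⟩
  · refine mul_ne_zero (Finset.prod_ne_zero_iff.2 fun j _ => ?_) (by simpa using hρ)
    simpa using hρ
  · refine ENNReal.mul_ne_top (ENNReal.prod_ne_top fun j _ => ?_) ENNReal.ofReal_ne_top
    rw [Measure.restrict_apply_univ]
    exact measure_ball_lt_top.ne
  · have hcomp : (fun x : EuclideanSpace ℝ (Fin n) => (2 * ρ)⁻¹ * (x i - (x₀ i - ρ))) =
        (fun t => (2 * ρ)⁻¹ * (t - (x₀ i - ρ))) ∘ Function.eval i ∘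
          (fun x : EuclideanSpace ℝ (Fin n) => (WithLp.ofLp x : Fin n → ℝ)) := rfl
    rw [hcomp, ← Measure.map_map hs ((measurable_pi_apply i).comp hmp'.measurable),
      ← Measure.map_map (measurable_pi_apply i) hmp'.measurable, hQ.map_eq]
    have hB : B = univ.pi fun j => Metric.ball (x₀ j) ρ := ball_pi _ hρ
    rw [hB, volume_pi, Measure.restrict_pi_pi, Measure.pi_map_eval, Measure.map_smul,
      map_volume_restrict_ball hρ, smul_smul]

end Cube

/-! ### Derivatives of curves from weak derivatives on Ω -/

section Coupling

variable {n : ℕ} {Ω : Set (EuclideanSpace ℝ (Fin n))} {V : Type*} [NormedAddCommGroup V]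
  [NormedSpace ℝ V]

theorem exists_lipschitzWith_bump_smul (η : EuclideanSpace ℝ (Fin n) → ℝ)
    (hη : ContDiff ℝ (⊤ : ℕ∞) η) (hηc : HasCompactSupport η) {G : EuclideanSpace ℝ (Fin n) → V}
    {C : ℝ≥0} (hG : LipschitzWith C G) {M : ℝ} (hM : ∀ x, ‖G x‖ ≤ M) :
    ∃ C', LipschitzWith C' fun x => η x • G x := by
  obtain ⟨D, hD⟩ := ContDiff.lipschitzWith_of_hasCompactSupport hηc hη (by simp)
  obtain ⟨N, hN⟩ := hηc.exists_bound_of_continuous hη.continuous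
  have hM0 : 0 ≤ M := (norm_nonneg _).trans (hM 0)
  have hN0 : 0 ≤ N := (norm_nonneg _).trans (hN 0)
  refine ⟨D * M.toNNReal + N.toNNReal * C, LipschitzWith.of_dist_le_mul fun x y => ?_⟩
  have h1 := hD.dist_le_mul x y
  have h2 := hG.dist_le_mul x y
  rw [dist_eq_norm] at h1 h2 ⊢
  have h3 : η x • G x - η y • G y = (η x - η y) • G x + η y • (G x - G y) := by
    rw [sub_smul, smul_sub]
    abel
  rw [h3]
  refine (norm_add_le _ _).trans ?_
  rw [norm_smul, norm_smul]
  push_cast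
  rw [Real.coe_toNNReal _ hM0, Real.coe_toNNReal _ hN0]
  have h4 := mul_le_mul h1 (hM x) (norm_nonneg _) (by positivity)
  have h5 := mul_le_mul (hN y) h2 (norm_nonneg _) hN0
  linarith

/-- If `R¹X(Ω; V) ⊆ W¹X(Ω; V)`, then there is a probability space with a uniformly distributed
variable `τ` over which every bounded Lipschitz curve has a strongly measurable weak derivative. -/
theorem exists_uniform_forall_lipschitzWith_deriv [CompleteSpace V] (hn : 0 < n) (hΩ : IsOpen Ω)
    (hΩne : Ω.Nonempty) (X : BanachFunctionSpace Ω) (hR : reshetnyakR X V ⊆ sobolevW X V) :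
    ∃ (P : Measure (EuclideanSpace ℝ (Fin n))) (τ : EuclideanSpace ℝ (Fin n) → ℝ),
      IsProbabilityMeasure P ∧ Measurable τ ∧ P.map τ = volume.restrict (Ioo (0 : ℝ) 1) ∧
      ∀ (F : ℝ → V) (C : ℝ≥0) (M : ℝ), LipschitzWith C F → (∀ t, ‖F t‖ ≤ M) →
        ∃ h : EuclideanSpace ℝ (Fin n) → V, Integrable h P ∧
          ∀ ℓ : StrongDual ℝ V, ‖ℓ‖ ≤ 1 → ∀ᵐ x ∂P, ℓ (h x) = deriv (ℓ ∘ F) (τ x) := by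
  obtain ⟨x₀, hx₀⟩ := hΩne
  obtain ⟨R, hR0, hRΩ⟩ := Metric.isOpen_iff.1 hΩ x₀ hx₀
  -- The bump has compact support in `Ω` and equals 1 on the ball that will contain the cube, so
  -- there `u` is `F ∘ τ`.
  let η : ContDiffBump x₀ := ⟨R / 4, R / 2, by positivity, by linarith⟩
  have hηs : tsupport η ⊆ Ω := by
    rw [η.tsupport_eq]
    exact (Metric.closedBall_subset_ball (by change R / 2 < R; linarith)).trans hRΩ
  let i : Fin n := ⟨0, hn⟩
  obtain ⟨Q, ρ, c, hQ, hQU, hρ, hc0, hct, hQmap⟩ := exists_cube_map_volume_restrict i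
    (Metric.ball_mem_nhds x₀ η.rIn_pos)
  let τ : EuclideanSpace ℝ (Fin n) → ℝ := fun x => (2 * ρ)⁻¹ * (x i - (x₀ i - ρ))
  have hτc : Continuous τ := by fun_prop
  have hQΩ : Q ⊆ Metric.closedBall x₀ η.rIn := hQU.trans Metric.ball_subset_closedBall
  have hcbΩ : Metric.closedBall x₀ η.rIn ⊆ Ω :=
    (Metric.closedBall_subset_ball (by change R / 4 < R; linarith)).trans hRΩ
  let P : Measure (EuclideanSpace ℝ (Fin n)) := c⁻¹ • volume.restrict Q
  have hPmap : P.map τ = volume.restrict (Ioo (0 : ℝ) 1) := by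
    rw [Measure.map_smul, hQmap, smul_smul, ENNReal.inv_mul_cancel hc0 hct, one_smul]
  have hP : IsProbabilityMeasure P := ⟨by
    rw [← preimage_univ (f := τ), ← Measure.map_apply hτc.measurable MeasurableSet.univ, hPmap]
    simp⟩
  refine ⟨P, τ, hP, hτc.measurable, hPmap, fun F C M hF hM => ?_⟩
  have hτl : LipschitzWith (2 * ρ)⁻¹.toNNReal τ := by
    refine LipschitzWith.of_dist_le_mul fun x y => ?_
    rw [Real.dist_eq, dist_eq_norm, Real.coe_toNNReal _ (by positivity)]
    have h1 : τ x - τ y = (2 * ρ)⁻¹ * (x - y) i := by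
      simp only [τ, PiLp.sub_apply]
      ring
    rw [h1, abs_mul, abs_of_pos (a := (2 * ρ)⁻¹) (by positivity)]
    gcongr
    exact PiLp.norm_apply_le (x - y) i
  have hcd : ContDiff ℝ (⊤ : ℕ∞) η := η.contDiff
  obtain ⟨C', hu⟩ := exists_lipschitzWith_bump_smul η hcd η.hasCompactSupport
    (hF.comp hτl) fun x => hM (τ x)
  set u : EuclideanSpace ℝ (Fin n) → V := fun x => η x • (F ∘ τ) x with hudef
  have huc : HasCompactSupport u := η.hasCompactSupport.smul_right
  have hus : tsupport u ⊆ Ω := (tsupport_smul_subset_left _ _).trans hηs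
  obtain ⟨-, hW⟩ := hR (mk_mem_reshetnyakR_of_lipschitzWith X hu huc hus)
  obtain ⟨v, -, hv⟩ := hW i
  have hvQ : IntegrableOn v Q :=
    (hv.2.1.integrableOn_compact_subset hcbΩ (isCompact_closedBall _ _)).mono_set hQΩ
  -- The factor `2 * ρ` cancels the slope of `τ` in direction `i`.
  refine ⟨fun x => (2 * ρ) • v x, (hvQ.smul_measure (ENNReal.inv_ne_top.2 hc0)).smul (2 * ρ),
    fun ℓ hℓ => ?_⟩
  have hℓu : LipschitzWith (‖ℓ‖₊ * C') (ℓ ∘ u) := ℓ.lipschitz.comp hu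
  have h1 := hv.pairing ℓ
  rw [pairing_mk hu.continuous] at h1
  have h2 := h1.unique hΩ (isWeakPartialDeriv_lineDeriv hℓu i)
  have h3 : ∀ᵐ x ∂(volume.restrict Ω), ℓ (v x) =
      lineDeriv ℝ (ℓ ∘ u) x (EuclideanSpace.single i 1) := by
    filter_upwards [coeFn_pairing ℓ v, AEEqFun.coeFn_mk
      (fun x => lineDeriv ℝ (ℓ ∘ u) x (EuclideanSpace.single i 1)) (μ := volume.restrict Ω)
      (stronglyMeasurable_lineDeriv hℓu.continuous).aestronglyMeasurable] with x hx hx'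
    rw [← hx, h2, hx']
  have h4 : ∀ᵐ x ∂(volume.restrict Q), ℓ ((2 * ρ) • v x) = deriv (ℓ ∘ F) (τ x) := by
    filter_upwards [ae_restrict_of_ae_restrict_of_subset (hQΩ.trans hcbΩ) h3,
      ae_restrict_mem hQ.measurableSet] with x hx hxQ
    have hev : ℓ ∘ u =ᶠ[𝓝 x] ℓ ∘ F ∘ τ := by
      filter_upwards [hQ.mem_nhds hxQ] with y hy
      simp [hudef, η.one_of_mem_closedBall (hQΩ hy)]
    rw [map_smul, hx, hev.lineDeriv_eq, lineDeriv, smul_eq_mul]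
    have hline : (fun t : ℝ => (ℓ ∘ F ∘ τ) (x + t • EuclideanSpace.single i (1 : ℝ))) =
        fun t => (fun s => (ℓ ∘ F) (τ x + s)) ((2 * ρ)⁻¹ * t) := by
      ext t
      simp only [Function.comp_apply]
      congr 2
      simp [τ]
      ring
    rw [hline, deriv_comp_mul_left (2 * ρ)⁻¹ (fun s => (ℓ ∘ F) (τ x + s)), deriv_comp_const_add,
      mul_zero, add_zero, smul_eq_mul, mul_inv_cancel_left₀ (by positivity)]
  exact Measure.ae_smul_measure h4 _

end Coupling

/-! ### From curves to vector measures -/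

section Transfer

/-- Every probability measure on a standard Borel space is an image of the uniform measure on the
unit interval. -/
theorem exists_measurable_map_restrict_Ioo_eq {Y : Type*} [MeasurableSpace Y] [StandardBorelSpace Y]
    (m : Measure Y) [IsProbabilityMeasure m] :
    ∃ q : ℝ → Y, Measurable q ∧ (volume.restrict (Ioo (0 : ℝ) 1)).map q = m := by
  have : Nonempty Y := m.nonempty_of_neZero
  obtain ⟨q, hq, hqm⟩ := m.exists_measurable_map_eq
  have hp : Measurable (projIcc (0 : ℝ) 1 zero_le_one) := continuous_projIcc.measurable
  refine ⟨q ∘ projIcc 0 1 zero_le_one, hq.comp hp, ?_⟩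
  rw [Measure.restrict_congr_set Ioo_ae_eq_Icc, ← map_comap_subtype_coe measurableSet_Icc,
    Measure.map_map (hq.comp hp) measurable_subtype_coe]
  have : (q ∘ projIcc (0 : ℝ) 1 zero_le_one) ∘ ((↑) : Icc (0 : ℝ) 1 → ℝ) = q := by
    ext x
    simp [projIcc_val]
  rw [this]
  exact hqm

/-- A signed measure dominated by a multiple of a finite measure has a bounded density. -/
theorem MeasureTheory.SignedMeasure.exists_bounded_density {Y : Type*} [MeasurableSpace Y]
    {m : Measure Y} [IsFiniteMeasure m] (s : SignedMeasure Y) {C : ℝ}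
    (hs : ∀ D, MeasurableSet D → |s D| ≤ C * m.real D) :
    ∃ k : Y → ℝ, Measurable k ∧ Integrable k m ∧ (∀ D, MeasurableSet D → ∫ y in D, k y ∂m = s D) ∧
      ∀ᵐ y ∂m, |k y| ≤ C := by
  have hac : s ≪ᵥ m.toENNRealVectorMeasure := by
    intro D hD
    by_cases hDm : MeasurableSet D
    · rw [Measure.toENNRealVectorMeasure_apply_measurable hDm] at hD
      simpa [Measure.real, hD] using hs D hDm
    · exact s.not_measurable hDm
  have hk := s.integrable_rnDeriv m
  have hset : ∀ D, MeasurableSet D → ∫ y in D, s.rnDeriv m y ∂m = s D := fun D hD => by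
    rw [← withDensityᵥ_apply hk hD, s.withDensityᵥ_rnDeriv_eq m hac]
  refine ⟨s.rnDeriv m, s.measurable_rnDeriv m, hk, hset, ?_⟩
  have hle := ae_le_of_forall_setIntegral_le hk (integrable_const C) fun D hD _ => by
    rw [hset D hD, setIntegral_const, smul_eq_mul, mul_comm]
    exact (le_abs_self _).trans (hs D hD)
  have hge := ae_le_of_forall_setIntegral_le (integrable_const (-C)) hk fun D hD _ => by
    rw [hset D hD, setIntegral_const, smul_eq_mul, mul_neg, mul_comm, neg_le]
    exact (neg_le_abs _).trans (hs D hD)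
  filter_upwards [hle, hge] with y h1 h2
  exact abs_le.2 ⟨h2, h1⟩

/-- The primitive of an integrable function is differentiable almost everywhere, with the expected
derivative. -/
theorem ae_deriv_integral_Iic {κ : ℝ → ℝ} (hκ : Integrable κ) :
    ∀ᵐ t, deriv (fun t => ∫ s in Iic t, κ s) t = κ t := by
  have hprim : (fun t => ∫ s in Iic t, κ s) =
      fun t => (∫ s in (0 : ℝ)..t, κ s) + ∫ s in Iic (0 : ℝ), κ s := by
    ext t
    rw [← intervalIntegral.integral_Iic_sub_Iic hκ.integrableOn hκ.integrableOn]
    ring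
  filter_upwards [LocallyIntegrable.ae_hasDerivAt_integral hκ.locallyIntegrable] with t ht
  rw [hprim]
  exact ((ht 0).add_const _).deriv

variable {V : Type*} [NormedAddCommGroup V] [NormedSpace ℝ V] [CompleteSpace V]

/-- A vector measure dominated by a multiple of a probability measure `m` is encoded by a bounded
Lipschitz curve whose scalar derivatives are the scalar densities of the measure along a
parametrisation of `m`. -/
theorem exists_lipschitzWith_deriv_eq_density {Y : Type*} [MeasurableSpace Y] {m : Measure Y}
    [IsFiniteMeasure m] {ν : VectorMeasure Y V} {C : ℝ≥0}
    (hν : ∀ D, MeasurableSet D → ‖ν D‖ ≤ C * m.real D) {q : ℝ → Y} (hq : Measurable q)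
    (hqm : (volume.restrict (Ioo (0 : ℝ) 1)).map q = m) :
    ∃ F : ℝ → V, LipschitzWith C F ∧ (∀ t, ‖F t‖ ≤ C) ∧
      ∀ ℓ : StrongDual ℝ V, ‖ℓ‖ ≤ 1 → ∃ k : Y → ℝ, Measurable k ∧ Integrable k m ∧
        (∀ D, MeasurableSet D → ∫ y in D, k y ∂m = ℓ (ν D)) ∧
        ∀ᵐ t ∂volume.restrict (Ioo (0 : ℝ) 1), deriv (ℓ ∘ F) t = k (q t) := by
  have hdens : ∀ ℓ : StrongDual ℝ V, ∃ k : Y → ℝ, ‖ℓ‖ ≤ 1 → Measurable k ∧ Integrable k m ∧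
      (∀ D, MeasurableSet D → ∫ y in D, k y ∂m = ℓ (ν D)) ∧ ∀ᵐ y ∂m, |k y| ≤ C := by
    intro ℓ
    by_cases hℓ : ‖ℓ‖ ≤ 1
    · obtain ⟨k, hk⟩ := SignedMeasure.exists_bounded_density (m := m) (C := C)
        (ν.mapRange (ℓ : V →+ ℝ) ℓ.continuous) fun D hD => by
          have := (ℓ.le_of_opNorm_le hℓ (ν D)).trans_eq (one_mul _)
          exact this.trans (hν D hD)
      exact ⟨k, fun _ => hk⟩
    · exact ⟨0, fun h => absurd h hℓ⟩
  choose k hk using hdens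
  set κ : StrongDual ℝ V → ℝ → ℝ := fun ℓ => (Ioo (0 : ℝ) 1).indicator (k ℓ ∘ q) with hκdef
  have hκint : ∀ ℓ : StrongDual ℝ V, ‖ℓ‖ ≤ 1 → Integrable (κ ℓ) := fun ℓ hℓ => by
    rw [hκdef, integrable_indicator_iff measurableSet_Ioo]
    refine Integrable.comp_measurable ?_ hq
    rw [hqm]
    exact (hk ℓ hℓ).2.1
  have hκb : ∀ ℓ : StrongDual ℝ V, ‖ℓ‖ ≤ 1 → ∀ᵐ t, ‖κ ℓ t‖ ≤ C := fun ℓ hℓ => by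
    have h1 := (hk ℓ hℓ).2.2.2
    rw [← hqm] at h1
    have h2 := (ae_restrict_iff' measurableSet_Ioo).1 (ae_of_ae_map hq.aemeasurable h1)
    filter_upwards [h2] with t ht
    by_cases htI : t ∈ Ioo (0 : ℝ) 1
    · simpa [κ, htI] using ht htI
    · simp [κ, htI]
  have hF : ∀ t : ℝ, ∃ y : V, ∀ ℓ : StrongDual ℝ V, ‖ℓ‖ ≤ 1 → ℓ y = ∫ s in Iic t, κ ℓ s := by
    intro t
    -- Formally `F t` is the integral of the density of `mt` with respect to `m` against `ν`. Since
    -- the scalar densities `k ℓ` are bounded, `exists_dual_eq_integral_mul` gives meaning to this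
    -- integral.
    set mt : Measure Y := ((volume.restrict (Ioo (0 : ℝ) 1)).restrict (Iic t)).map q with hmt
    have hmtm : mt ≪ m := by
      rw [hmt, ← hqm]
      exact (Measure.map_mono Measure.restrict_le_self hq).absolutelyContinuous
    obtain ⟨y, hy⟩ := exists_dual_eq_integral_mul (d := k) (μ := m) C.2
      (fun ℓ hℓ => (hk ℓ hℓ).1.aestronglyMeasurable) (fun ℓ hℓ => (hk ℓ hℓ).2.2.2)
      (fun A hA _ => ⟨ν A, fun ℓ hℓ => ((hk ℓ hℓ).2.2.1 A hA).symm⟩)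
      (Measure.integrable_toReal_rnDeriv (μ := mt))
    refine ⟨y, fun ℓ hℓ => ?_⟩
    have h1 := integral_rnDeriv_smul (f := k ℓ) hmtm
    simp only [smul_eq_mul] at h1
    rw [hy ℓ hℓ, h1, hmt, integral_map hq.aemeasurable (hk ℓ hℓ).1.aestronglyMeasurable,
      Measure.restrict_restrict measurableSet_Iic, ← setIntegral_indicator measurableSet_Ioo]
    rfl
  choose F hF using hF
  refine ⟨F, ?_, ?_, fun ℓ hℓ => ⟨k ℓ, (hk ℓ hℓ).1, (hk ℓ hℓ).2.1, (hk ℓ hℓ).2.2.1, ?_⟩⟩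
  · refine LipschitzWith.of_dist_le_mul fun a b => ?_
    rw [dist_eq_norm]
    refine norm_le_of_forall_dual_le fun ℓ hℓ => ?_
    rw [Real.dist_eq, ← Real.norm_eq_abs, map_sub, hF a ℓ hℓ, hF b ℓ hℓ, intervalIntegral.integral_Iic_sub_Iic
      (hκint ℓ hℓ).integrableOn (hκint ℓ hℓ).integrableOn]
    refine intervalIntegral.norm_integral_le_of_norm_le_const_ae ?_
    filter_upwards [hκb ℓ hℓ] with t ht _ using ht
  · refine fun t => norm_le_of_forall_dual_le fun ℓ hℓ => ?_
    rw [hF t ℓ hℓ, setIntegral_indicator measurableSet_Ioo, ← Real.norm_eq_abs]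
    refine (norm_setIntegral_le_of_norm_le_const_ae' (C := C) ?_ ?_).trans ?_
    · exact (measure_mono inter_subset_right).trans_lt measure_Ioo_lt_top
    · filter_upwards [hκb ℓ hℓ] with s hs hsI
      simpa [κ, hsI.2] using hs
    · refine mul_le_of_le_one_right C.2 ?_
      refine (measureReal_mono inter_subset_right measure_Ioo_lt_top.ne).trans ?_
      simp
  · have hℓF : ℓ ∘ F = fun t => ∫ s in Iic t, κ ℓ s := funext fun t => hF t ℓ hℓ
    rw [hℓF]
    filter_upwards [ae_restrict_of_ae (ae_deriv_integral_Iic (hκint ℓ hℓ)),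
      ae_restrict_mem measurableSet_Ioo] with t ht htI
    rw [ht]
    simp [κ, htI]

/-- If weak derivatives of bounded Lipschitz curves exist along `τ`, then a vector measure
dominated by a probability measure on a standard Borel space has a density on a suitable coupling. -/
theorem exists_coupling_density {E : Type*} [MeasurableSpace E] {P : Measure E} {τ : E → ℝ}
    (hτ : Measurable τ) (hPτ : P.map τ = volume.restrict (Ioo (0 : ℝ) 1))
    (hder : ∀ (F : ℝ → V) (C : ℝ≥0) (M : ℝ), LipschitzWith C F → (∀ t, ‖F t‖ ≤ M) →
      ∃ h, Integrable h P ∧ ∀ ℓ : StrongDual ℝ V, ‖ℓ‖ ≤ 1 →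
        ∀ᵐ x ∂P, ℓ (h x) = deriv (ℓ ∘ F) (τ x))
    {Y : Type*} [MeasurableSpace Y] [StandardBorelSpace Y] {m : Measure Y} [IsProbabilityMeasure m]
    {ν : VectorMeasure Y V} {C : ℝ≥0} (hν : ∀ D, MeasurableSet D → ‖ν D‖ ≤ C * m.real D) :
    ∃ (r : E → Y) (h : E → V), Measurable r ∧ P.map r = m ∧ Integrable h P ∧
      ∀ D, MeasurableSet D → ∫ x in r ⁻¹' D, h x ∂P = ν D := by
  obtain ⟨q, hq, hqm⟩ := exists_measurable_map_restrict_Ioo_eq m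
  obtain ⟨F, hFL, hFb, hFd⟩ := exists_lipschitzWith_deriv_eq_density hν hq hqm
  obtain ⟨h, hh, hhℓ⟩ := hder F C C hFL hFb
  have hr : P.map (q ∘ τ) = m := by rw [← Measure.map_map hq hτ, hPτ, hqm]
  refine ⟨q ∘ τ, h, hq.comp hτ, hr, hh, fun D hD => eq_of_forall_dual_eq fun ℓ hℓ => ?_⟩
  obtain ⟨k, hkm, -, hkD, hkF⟩ := hFd ℓ hℓ
  rw [← hPτ] at hkF
  -- Along the coupling, `ℓ ∘ h` is the scalar density of `ℓ ∘ ν` composed with `q ∘ τ`; integrating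
  -- over preimages recovers `ℓ (ν D)`.
  have hae : ∀ᵐ x ∂P, ℓ (h x) = k ((q ∘ τ) x) := by
    filter_upwards [hhℓ ℓ hℓ, ae_of_ae_map hτ.aemeasurable hkF] with x h1 h2
    rw [h1, h2, Function.comp_apply]
  rw [← ℓ.integral_comp_comm hh.integrableOn, integral_congr_ae (ae_restrict_of_ae hae),
    ← setIntegral_map hD hkm.aestronglyMeasurable (hq.comp hτ).aemeasurable, hr, hkD D hD]

end Transfer

/-- If weak derivatives of bounded Lipschitz curves exist along `τ`, then the space has the
Radon–Nikodým property. -/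
theorem hasRadonNikodymProperty_of_forall_lipschitzWith_deriv {V : Type v} [NormedAddCommGroup V]
    [NormedSpace ℝ V] [CompleteSpace V] {E : Type} [MeasurableSpace E] {P : Measure E}
    [IsFiniteMeasure P] {τ : E → ℝ}
    (hτ : Measurable τ) (hPτ : P.map τ = volume.restrict (Ioo (0 : ℝ) 1))
    (hder : ∀ (F : ℝ → V) (C : ℝ≥0) (M : ℝ), LipschitzWith C F → (∀ t, ‖F t‖ ≤ M) →
      ∃ h, Integrable h P ∧ ∀ ℓ : StrongDual ℝ V, ‖ℓ‖ ≤ 1 →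
        ∀ᵐ x ∂P, ℓ (h x) = deriv (ℓ ∘ F) (τ x)) :
    HasRadonNikodymProperty.{v, w} V := by
  intro S _ μ _ _ ν hνfin hνμ
  have hfin : IsFiniteMeasure ν.variation := ⟨hνfin⟩
  rcases eq_or_ne ν.variation 0 with h0 | h0
  · refine ⟨0, integrable_zero _ _ _, fun A hA => ?_⟩
    have := ν.enorm_measure_le_variation A
    simpa [h0] using this
  have hne : NeZero ν.variation := ⟨h0⟩
  set K : ℝ≥0∞ := ν.variation univ with hK
  have hK0 : K ≠ 0 := by simpa [hK] using h0
  -- Absolute continuity with respect to `μ` gives no linear bound on `ν`. The normalised variation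
  -- does, and the density relative to `μ` then follows by the chain rule.
  set μ' : Measure S := K⁻¹ • ν.variation with hμ'
  have hprob : IsProbabilityMeasure μ' :=
    ⟨by rw [hμ', Measure.smul_apply, smul_eq_mul, ENNReal.inv_mul_cancel hK0 hνfin.ne]⟩
  have hle : ∀ A, ‖ν A‖ ≤ K.toNNReal * μ'.real A := fun A => by
    have h1 : ‖ν A‖ₑ ≤ K * μ' A := by
      rw [hμ', Measure.smul_apply, smul_eq_mul, ← mul_assoc, ENNReal.mul_inv_cancel hK0 hνfin.ne,
        one_mul]
      exact ν.enorm_measure_le_variation A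
    have h2 := ENNReal.toReal_mono (ENNReal.mul_ne_top hνfin.ne (measure_ne_top _ _)) h1
    rwa [toReal_enorm, ENNReal.toReal_mul] at h2
  have hac : μ' ≪ μ := by
    refine (Measure.AbsolutelyContinuous.mk fun A hA hA0 => ?_ : ν.variation ≪ μ).smul_left _
    exact (ν.variation_apply_eq_zero hA).2 fun B hBA hB => hνμ B hB (measure_mono_null hBA hA0)
  obtain ⟨g, hg, hgν⟩ := exists_integrable_density_of_coupling (μ := μ') (ν := ν)
    (fun A _ hA0 => by simpa [Measure.real, hA0] using hle A) fun Y _ _ c hc => by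
      have hpm : IsProbabilityMeasure (μ'.map c) := Measure.isProbabilityMeasure_map hc.aemeasurable
      obtain ⟨r, h, hr, hrm, hh, hhD⟩ := exists_coupling_density hτ hPτ hder (m := μ'.map c)
        (ν := ν.map c) (C := K.toNNReal) fun D hD => by
          rw [VectorMeasure.map_apply _ hc hD, map_measureReal_apply hc hD]
          exact hle _
      refine ⟨E, inferInstance, P, r, h, inferInstance, hr, hrm, hh, fun D hD => ?_⟩
      rw [hhD D hD, VectorMeasure.map_apply _ hc hD]
  refine ⟨fun x => (μ'.rnDeriv μ x).toReal • g x, (integrable_rnDeriv_smul_iff hac).2 hg,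
    fun A hA => ?_⟩
  rw [setIntegral_rnDeriv_smul hac hA, hgν A hA]

end

theorem mainTheorem1 {n : ℕ} (hn : 0 < n) (Ω : Set (EuclideanSpace ℝ (Fin n))) (hΩ : IsOpen Ω)
    (hΩne : Ω.Nonempty) (X : BanachFunctionSpace Ω)
    (V : Type v) [NormedAddCommGroup V] [NormedSpace ℝ V] [CompleteSpace V] :
    HasRadonNikodymProperty.{v, w} V ↔ reshetnyakR X V = sobolevW X V := by
  refine ⟨fun hV => (hV.reshetnyakR_subset_sobolevW hΩ X).antisymm (sobolevW_subset_reshetnyakR X),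
    fun h => ?_⟩
  obtain ⟨P, τ, hP, hτ, hPτ, hder⟩ := exists_uniform_forall_lipschitzWith_deriv hn hΩ hΩne X h.le
  exact hasRadonNikodymProperty_of_forall_lipschitzWith_deriv hτ hPτ hder
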